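/- **Setting.** Let $X\in\mathbb R^{d\times n}$ have linearly independent rows (so $1\le d\le n$), with largest and smallest singular values $\sigma_{\max}(X)\ge\sigma_{\min}(X)>0$ and $\kappa(X)=\sigma_{\max}(X)/\sigma_{\min}(X)$. Let $m\le n$, let $W^\star\in\mathbb R^{m\times d}$ have rank $r^\star$ and singular values $\sigma_1(W^\star)\ge\sigma_2(W^\star)\ge\cdots$, and let $Y=W^\star X+\mathcal E$, where $\mathcal E\in\mathbb R^{m\times n}$ has i.i.d. $\mathcal N(0,\varepsilon^2)$ entries, $\varepsilon\ge 0$. Let $\sigma_1^\star\ge\sigma_2^\star\ge\cdots\ge 0$ be the singular values of $Y$ (extended by zeros), and for a target rank $r\ge1$ put $$\mathcal T_k^\star=\min\Big\{\min_{j>k}|\sigma_k^\star-\sigma_j^\star|,\ \sigma_k^\star\Big\},\qquad \mathcal T_{\min}^\star=\min_{1\le k\le r}\mathcal T_k^\star .$$ **Algorithm.** Set $Y_1=Y$; for $k=1,\dots,r$ an arbitrary subroutine returns $(a_k,b_k)=\texttt{rank-1}(Y_k,X,t)\in\mathbb R^d\times\mathbb R^m$, and $Y_{k+1}=Y_k-b_ka_k^\top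 X$. Let $(\bar a_k,\bar b_k)$ be any minimizer of $\tfrac12\|Y_k-ba^\top X\|_F^2$ over $a\in\mathbb R^d$, $b\in\mathbb R^m$, and let $\delta_k=b_ka_k^\top-\bar b_k\bar a_k^\top$ be the numerical error of step $k$. **Theorem.** There is an absolute constant $c>0$, and for every $\gamma_0<1$ a constant $C>0$ depending only on $\gamma_0$, such that for all data as above and every $\gamma\in(0,\gamma_0]$ the following holds with probability at least $1-\gamma$, simultaneously for all choices of the subroutine: if $\mathcal T_{\min}^\star>0$ and $$\varepsilon\le c\,\frac{\mathcal T_{\min}^\star}{\sqrt n+\sqrt{\log(1/\gamma)}},$$ then $$\Big\|W^\star-\sum_{k=1}^r b_ka_k^\top\Big\|_F\le \kappa(X)\Big(\sum_{k=r+1}^{r^\star}\sigma_k(W^\star)+\sum_{k=1}^r\sum_{k'=1}^{k}\|\delta_{k'}\|_F\prod_{j=k'+1}^{k}\Big(2+\frac{6\sigma_j^\star}{\mathcal T_k^\star}\Big)\Big)+C\,\frac{\varepsilon\sqrt{n\log(1/\gamma)}}{\sigma_{\min}(X)}\Big(r+\sqrt{\frac{\min\{r^\star,r\}}{\mathcal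 T_{\min}^\star}}\Big).$$ -/

import Mathlib

open MeasureTheory ProbabilityTheory
open scoped NNReal Matrix.Norms.Frobenius

/-! All indices are zero-based: index `k` here is the index `k + 1` of the usual one-based
numbering of singular values and of algorithm steps. Matrix norms `‖·‖` are Frobenius norms. -/

namespace SeqLowRank

noncomputable section

/-- The `k`-th largest singular value of a real matrix (zero-based, with multiplicity);
it vanishes for `k ≥ rank A`. -/
def sv {p q : ℕ} (A : Matrix (Fin p) (Fin q) ℝ) (k : ℕ) : ℝ :=
  (Matrix.toEuclideanLin A).singularValues k

/-- The largest singular value. -/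
def sigmaMax {p q : ℕ} (A : Matrix (Fin p) (Fin q) ℝ) : ℝ := sv A 0

/-- The smallest singular value of a `p × q` matrix with `p ≤ q`, i.e. the `p`-th largest one.
It is positive iff `p ≥ 1` and the rows are linearly independent. -/
def sigmaMin {p q : ℕ} (A : Matrix (Fin p) (Fin q) ℝ) : ℝ := sv A (p - 1)

/-- The condition number `σ_max / σ_min`. -/
def cond {p q : ℕ} (A : Matrix (Fin p) (Fin q) ℝ) : ℝ := sigmaMax A / sigmaMin A

/-- The singular value gap `min {min_{j > k} |σ_k - σ_j|, σ_k}` of a matrix. -/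
def gap {p q : ℕ} (Y : Matrix (Fin p) (Fin q) ℝ) (k : ℕ) : ℝ :=
  min (⨅ j : {j : ℕ // k < j}, |sv Y k - sv Y j|) (sv Y k)

/-- The minimum of the gaps of the first `r` singular values (meaningful for `r ≥ 1`). -/
def gapMin {p q : ℕ} (Y : Matrix (Fin p) (Fin q) ℝ) (r : ℕ) : ℝ :=
  ⨅ k : Fin r, gap Y k

variable {m d n : ℕ}

/-- A subroutine `rank-1 (Y, X, t)` returning a pair `(a, b)` of vectors. -/
abbrev Rank1Routine (m d n : ℕ) : Type :=
  Matrix (Fin m) (Fin n) ℝ → Matrix (Fin d) (Fin n) ℝ → ℕ → (Fin d → ℝ) × (Fin m → ℝ)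

/-- The rank-one coefficient matrix `b aᵀ` of a pair `(a, b)`. -/
def outer (ab : (Fin d → ℝ) × (Fin m → ℝ)) : Matrix (Fin m) (Fin d) ℝ :=
  Matrix.vecMulVec ab.2 ab.1

/-- The deflated label matrices of the inexact sequential algorithm: start from `Y`, and at each
step subtract `b_k a_kᵀ X`, where `(a_k, b_k)` is what the subroutine returns on the current label
matrix. The subroutine may change from step to step (other seeds, other initializations). -/
def deflated (rank1 : ℕ → Rank1Routine m d n) (X : Matrix (Fin d) (Fin n) ℝ) (t : ℕ)
    (Y : Matrix (Fin m) (Fin n) ℝ) : ℕ → Matrix (Fin m) (Fin n) ℝ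
  | 0 => Y
  | k + 1 => deflated rank1 X t Y k - outer (rank1 k (deflated rank1 X t Y k) X t) * X

/-- The pair `(a_k, b_k)` returned by the inexact sequential algorithm at step `k`. -/
def output (rank1 : ℕ → Rank1Routine m d n) (X : Matrix (Fin d) (Fin n) ℝ) (t : ℕ)
    (Y : Matrix (Fin m) (Fin n) ℝ) (k : ℕ) : (Fin d → ℝ) × (Fin m → ℝ) :=
  rank1 k (deflated rank1 X t Y k) X t

/-- `(a, b)` is an exact solution of the rank-one problem: it minimizes
`½ ‖Y - b aᵀ X‖_F²` over all pairs of vectors. -/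
def IsExactRank1 (X : Matrix (Fin d) (Fin n) ℝ) (Y : Matrix (Fin m) (Fin n) ℝ)
    (ab : (Fin d → ℝ) × (Fin m → ℝ)) : Prop :=
  ∀ ab' : (Fin d → ℝ) × (Fin m → ℝ),
    1 / 2 * ‖Y - outer ab * X‖ ^ 2 ≤ 1 / 2 * ‖Y - outer ab' * X‖ ^ 2

/-- The accumulated numerical error of `r` steps: with `e k` the Frobenius norm of the numerical
error `δ_k`, the sum over `k` and `k' ≤ k` of `e k' ∏_{k' < j ≤ k} (2 + 6 σ_j(Y) / gap_k(Y))`. -/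
def accumulatedError (Y : Matrix (Fin m) (Fin n) ℝ) (e : ℕ → ℝ) (r : ℕ) : ℝ :=
  ∑ k ∈ Finset.range r, ∑ k' ∈ Finset.range (k + 1),
    e k' * ∏ j ∈ Finset.Ioc k' k, (2 + 6 * sv Y j / gap Y k)

end

end SeqLowRank

/-! An exact rank-one step subtracts a best rank-one approximation `b wᵀ` of `Z`, the label matrix
projected to the row space of `X`. The remainder `Z'` is the compression of `Z` to the orthogonal
complements of `b` and `w`. Weyl's inequality gives `σ_{k+1}(Z) ≤ σ_k(Z')`, and the exact loss
`‖Z‖² - ‖Z'‖² ≤ σ_0(Z)²` forces equality throughout: the step shifts the singular values by one.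

Being linear, the successive compressions act separately on the signal `M = W X` and on the noise,
and each step adds its numerical error `Δ_k`. Hence after `r` steps the singular values `x` of the
compressed signal satisfy `x_{i+j} ≤ σ_{r+i}(M) + H_j`, where `H_j` is twice the noise level plus
twice the errors made before step `r - 1 - j`. Charging each `x_t` either to a tail singular value
or to some `H_j` bounds `‖x‖₂` by `∑ σ_{r+i}(M) + 2 ∑ H_j`, with constant `1` on the tail. Dividing
by `σ_min(X)` transfers the estimate from `W X` to `W`.

The error of step `l` is thus counted with weight `4` at every later step, whereas the gaps bound
the corresponding product of factors `2 + 6 σ_j / gap_k` below by `8`. The operator norm of the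
noise is controlled by a union bound over nets of the two unit balls, dilated by a factor `2`. -/

namespace SeqLowRank

section SingularValues

open Module InnerProductSpace LinearMap

variable {𝕜 : Type*} [RCLike 𝕜]
  {E : Type*} [NormedAddCommGroup E] [InnerProductSpace 𝕜 E] [FiniteDimensional 𝕜 E]
  {F : Type*} [NormedAddCommGroup F] [InnerProductSpace 𝕜 F] [FiniteDimensional 𝕜 F]
  {H : Type*} [NormedAddCommGroup H] [InnerProductSpace 𝕜 H] [FiniteDimensional 𝕜 H]

/-- The orthonormal basis of right singular vectors of `T`, ordered by decreasing singular value. -/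
noncomputable def rightSingularBasis (T : E →ₗ[𝕜] F) :
    OrthonormalBasis (Fin (finrank 𝕜 E)) 𝕜 E :=
  T.isSymmetric_adjoint_comp_self.eigenvectorBasis rfl

/-- The span of the right singular vectors of `T` with indices in `s`; the initial and final
segments of indices give the extremal subspaces of the min-max principle. -/
noncomputable def rightSingularSpan (T : E →ₗ[𝕜] F) (s : Finset (Fin (finrank 𝕜 E))) :
    Submodule 𝕜 E :=
  Submodule.span 𝕜 (Set.range fun i : s => rightSingularBasis T i)

theorem finrank_rightSingularSpan (T : E →ₗ[𝕜] F) (s : Finset (Fin (finrank 𝕜 E))) :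
    finrank 𝕜 (rightSingularSpan T s) = s.card := by
  have hli : LinearIndependent 𝕜 fun i : s => rightSingularBasis T i :=
    (rightSingularBasis T).orthonormal.linearIndependent.comp _ Subtype.val_injective
  rw [rightSingularSpan, finrank_span_eq_card hli, Fintype.card_coe]

theorem rightSingularSpan_univ (T : E →ₗ[𝕜] F) : rightSingularSpan T Finset.univ = ⊤ :=
  Submodule.eq_top_of_finrank_eq (by simp [finrank_rightSingularSpan])

theorem inner_rightSingularBasis_eq_zero {T : E →ₗ[𝕜] F} {s : Finset (Fin (finrank 𝕜 E))} {x : E}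
    (hx : x ∈ rightSingularSpan T s) {i : Fin (finrank 𝕜 E)} (hi : i ∉ s) :
    inner 𝕜 (rightSingularBasis T i) x = 0 := by
  suffices rightSingularSpan T s ≤ (𝕜 ∙ rightSingularBasis T i)ᗮ from
    Submodule.mem_orthogonal_singleton_iff_inner_right.1 (this hx)
  rw [rightSingularSpan, Submodule.span_le]
  rintro _ ⟨j, rfl⟩
  exact Submodule.mem_orthogonal_singleton_iff_inner_right.2
    ((rightSingularBasis T).orthonormal.inner_eq_zero (ne_of_mem_of_not_mem j.2 hi).symm)

theorem sq_norm_apply_eq_sum (T : E →ₗ[𝕜] F) (x : E) :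
    ‖T x‖ ^ 2 = ∑ i : Fin (finrank 𝕜 E),
      T.singularValues i ^ 2 * ‖inner 𝕜 (rightSingularBasis T i) x‖ ^ 2 := by
  have hsymm := T.isSymmetric_adjoint_comp_self
  have hcoord (i : Fin (finrank 𝕜 E)) :
      inner 𝕜 (rightSingularBasis T i) ((adjoint T ∘ₗ T) x) =
        (T.singularValues i ^ 2 : ℝ) * inner 𝕜 (rightSingularBasis T i) x := by
    rw [← hsymm, rightSingularBasis, hsymm.apply_eigenvectorBasis, inner_smul_left,
      RCLike.conj_ofReal, T.sq_singularValues_fin rfl]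
  rw [← inner_self_eq_norm_sq (𝕜 := 𝕜), ← adjoint_inner_right, ← comp_apply,
    ← (rightSingularBasis T).sum_inner_mul_inner, map_sum]
  refine Finset.sum_congr rfl fun i _ => ?_
  rw [hcoord, ← inner_conj_symm x, mul_left_comm, RCLike.conj_mul]
  norm_cast

theorem norm_apply_rightSingularBasis (T : E →ₗ[𝕜] F) (i : Fin (finrank 𝕜 E)) :
    ‖T (rightSingularBasis T i)‖ = T.singularValues i := by
  rw [← sq_eq_sq₀ (norm_nonneg _) (T.singularValues_nonneg i), sq_norm_apply_eq_sum]
  simp [(rightSingularBasis T).inner_eq_ite, apply_ite]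

theorem sum_sq_norm_apply_eq_sum_sq_singularValues {ι : Type*} [Fintype ι] (T : E →ₗ[𝕜] F)
    (e : OrthonormalBasis ι 𝕜 E) :
    ∑ j, ‖T (e j)‖ ^ 2 = ∑ i : Fin (finrank 𝕜 E), T.singularValues i ^ 2 := by
  simp_rw [sq_norm_apply_eq_sum]
  rw [Finset.sum_comm]
  simp_rw [← Finset.mul_sum, e.sum_sq_norm_inner_left, (rightSingularBasis T).norm_eq_one, one_pow,
    mul_one]

theorem singularValues_mul_norm_le {T : E →ₗ[𝕜] F} {s : Finset (Fin (finrank 𝕜 E))} {k : ℕ}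
    (hs : ∀ i ∈ s, (i : ℕ) ≤ k) {x : E} (hx : x ∈ rightSingularSpan T s) :
    T.singularValues k * ‖x‖ ≤ ‖T x‖ := by
  refine (sq_le_sq₀ (mul_nonneg (T.singularValues_nonneg k) (norm_nonneg _)) (norm_nonneg _)).1 ?_
  rw [mul_pow, sq_norm_apply_eq_sum, ← (rightSingularBasis T).sum_sq_norm_inner_right,
    Finset.mul_sum]
  refine Finset.sum_le_sum fun i _ => ?_
  by_cases hi : i ∈ s
  · gcongr
    · exact T.singularValues_nonneg k
    · exact T.singularValues_antitone (hs i hi)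
  · simp [inner_rightSingularBasis_eq_zero hx hi]

theorem norm_apply_le_singularValues_mul {T : E →ₗ[𝕜] F} {s : Finset (Fin (finrank 𝕜 E))}
    {k : ℕ} (hs : ∀ i ∈ s, k ≤ (i : ℕ)) {x : E} (hx : x ∈ rightSingularSpan T s) :
    ‖T x‖ ≤ T.singularValues k * ‖x‖ := by
  refine (sq_le_sq₀ (norm_nonneg _) (mul_nonneg (T.singularValues_nonneg k) (norm_nonneg _))).1 ?_
  rw [mul_pow, sq_norm_apply_eq_sum, ← (rightSingularBasis T).sum_sq_norm_inner_right,
    Finset.mul_sum]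
  refine Finset.sum_le_sum fun i _ => ?_
  by_cases hi : i ∈ s
  · gcongr
    · exact T.singularValues_nonneg _
    · exact T.singularValues_antitone (hs i hi)
  · simp [inner_rightSingularBasis_eq_zero hx hi]

theorem exists_finrank_eq_forall_singularValues_mul_norm_le (T : E →ₗ[𝕜] F) {k : ℕ}
    (hk : k < finrank 𝕜 E) :
    ∃ V : Submodule 𝕜 E, finrank 𝕜 V = k + 1 ∧ ∀ x ∈ V, T.singularValues k * ‖x‖ ≤ ‖T x‖ := by
  refine ⟨rightSingularSpan T {i | i < k + 1}, ?_, fun x hx =>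
    singularValues_mul_norm_le (fun i hi => by simpa [Nat.lt_succ_iff] using hi) hx⟩
  rw [finrank_rightSingularSpan, Fin.card_filter_val_lt, min_eq_right hk]

theorem exists_finrank_le_forall_norm_le_singularValues_mul (T : E →ₗ[𝕜] F) (k : ℕ) :
    ∃ W : Submodule 𝕜 E, finrank 𝕜 E ≤ finrank 𝕜 W + k ∧
      ∀ x ∈ W, ‖T x‖ ≤ T.singularValues k * ‖x‖ := by
  refine ⟨rightSingularSpan T {i | ¬ i < k}, ?_, fun x hx =>
    norm_apply_le_singularValues_mul (fun i hi => by simpa using hi) hx⟩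
  have := Finset.card_filter_add_card_filter_not (s := Finset.univ)
    fun i : Fin (finrank 𝕜 E) => (i : ℕ) < k
  rw [Fin.card_filter_val_lt, Finset.card_fin] at this
  rw [finrank_rightSingularSpan]
  lia

theorem norm_apply_le_singularValues_zero_mul (T : E →ₗ[𝕜] F) (x : E) :
    ‖T x‖ ≤ T.singularValues 0 * ‖x‖ :=
  norm_apply_le_singularValues_mul (fun _ _ => Nat.zero_le _)
    (rightSingularSpan_univ T ▸ Submodule.mem_top)

theorem singularValues_pred_finrank_mul_norm_le (T : E →ₗ[𝕜] F) (x : E) :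
    T.singularValues (finrank 𝕜 E - 1) * ‖x‖ ≤ ‖T x‖ :=
  singularValues_mul_norm_le (fun i _ => Nat.le_pred_of_lt i.isLt)
    (rightSingularSpan_univ T ▸ Submodule.mem_top)

theorem exists_mem_inf_ne_zero {V W : Submodule 𝕜 E}
    (h : finrank 𝕜 E < finrank 𝕜 V + finrank 𝕜 W) : ∃ x ∈ V ⊓ W, x ≠ 0 := by
  refine Submodule.exists_mem_ne_zero_of_ne_bot fun hbot => h.not_ge ?_
  exact Submodule.finrank_add_finrank_le_of_disjoint (disjoint_iff.2 hbot)

theorem le_singularValues_of_forall_mem {T : E →ₗ[𝕜] F} {k : ℕ} {c : ℝ} (V : Submodule 𝕜 E)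
    (hV : k < finrank 𝕜 V) (h : ∀ x ∈ V, c * ‖x‖ ≤ ‖T x‖) : c ≤ T.singularValues k := by
  obtain ⟨W, hW, hTW⟩ := exists_finrank_le_forall_norm_le_singularValues_mul T k
  obtain ⟨x, ⟨hxV, hxW⟩, hx⟩ := exists_mem_inf_ne_zero (V := V) (W := W) (by lia)
  exact le_of_mul_le_mul_right ((h x hxV).trans (hTW x hxW)) (norm_pos_iff.2 hx)

theorem singularValues_le_of_forall_mem {T : E →ₗ[𝕜] F} {k : ℕ} {c : ℝ} (hc : 0 ≤ c)
    (W : Submodule 𝕜 E) (hW : finrank 𝕜 E ≤ finrank 𝕜 W + k) (h : ∀ x ∈ W, ‖T x‖ ≤ c * ‖x‖) :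
    T.singularValues k ≤ c := by
  rcases le_or_gt (finrank 𝕜 E) k with hk | hk
  · rwa [T.singularValues_of_finrank_le hk]
  obtain ⟨V, hV, hTV⟩ := exists_finrank_eq_forall_singularValues_mul_norm_le T hk
  obtain ⟨x, ⟨hxV, hxW⟩, hx⟩ := exists_mem_inf_ne_zero (V := V) (W := W) (by lia)
  exact le_of_mul_le_mul_right ((hTV x hxV).trans (h x hxW)) (norm_pos_iff.2 hx)

theorem finrank_le_finrank_inf_add {V W : Submodule 𝕜 E} {i j : ℕ}
    (hV : finrank 𝕜 E ≤ finrank 𝕜 V + i) (hW : finrank 𝕜 E ≤ finrank 𝕜 W + j) :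
    finrank 𝕜 E ≤ finrank 𝕜 (V ⊓ W : Submodule 𝕜 E) + (i + j) := by
  have := Submodule.finrank_sup_add_finrank_inf_eq V W
  have := (V ⊔ W).finrank_le
  lia

theorem finrank_le_finrank_comap_add {W : Submodule 𝕜 F} {i : ℕ}
    (hW : finrank 𝕜 F ≤ finrank 𝕜 W + i) (T : E →ₗ[𝕜] F) :
    finrank 𝕜 E ≤ finrank 𝕜 (W.comap T) + i := by
  have hker : W.comap T = ker (W.mkQ ∘ₗ T) := by rw [ker_comp, Submodule.ker_mkQ]
  have := (W.mkQ ∘ₗ T).finrank_range_add_finrank_ker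
  have := (range (W.mkQ ∘ₗ T)).finrank_le
  have := W.finrank_quotient_add_finrank
  rw [hker]
  lia

theorem singularValues_add_le (S T : E →ₗ[𝕜] F) (i j : ℕ) :
    (S + T).singularValues (i + j) ≤ S.singularValues i + T.singularValues j := by
  obtain ⟨V, hV, hSV⟩ := exists_finrank_le_forall_norm_le_singularValues_mul S i
  obtain ⟨W, hW, hTW⟩ := exists_finrank_le_forall_norm_le_singularValues_mul T j
  refine singularValues_le_of_forall_mem (add_nonneg (S.singularValues_nonneg i)
    (T.singularValues_nonneg j)) (V ⊓ W) (finrank_le_finrank_inf_add hV hW) ?_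
  rintro x ⟨hxV, hxW⟩
  rw [add_mul]
  exact (norm_add_le _ _).trans (add_le_add (hSV x hxV) (hTW x hxW))

theorem singularValues_comp_le (S : F →ₗ[𝕜] H) (T : E →ₗ[𝕜] F) (i j : ℕ) :
    (S ∘ₗ T).singularValues (i + j) ≤ S.singularValues i * T.singularValues j := by
  obtain ⟨V, hV, hSV⟩ := exists_finrank_le_forall_norm_le_singularValues_mul S i
  obtain ⟨W, hW, hTW⟩ := exists_finrank_le_forall_norm_le_singularValues_mul T j
  refine singularValues_le_of_forall_mem (mul_nonneg (S.singularValues_nonneg i)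
    (T.singularValues_nonneg j)) (V.comap T ⊓ W)
    (finrank_le_finrank_inf_add (finrank_le_finrank_comap_add hV T) hW) ?_
  rintro x ⟨hxV, hxW⟩
  calc ‖S (T x)‖ ≤ S.singularValues i * ‖T x‖ := hSV _ hxV
    _ ≤ S.singularValues i * (T.singularValues j * ‖x‖) := by
      gcongr
      · exact S.singularValues_nonneg i
      · exact hTW x hxW
    _ = S.singularValues i * T.singularValues j * ‖x‖ := (mul_assoc _ _ _).symm

theorem singularValues_le_singularValues_adjoint (T : E →ₗ[𝕜] F) (k : ℕ) :
    T.singularValues k ≤ (adjoint T).singularValues k := by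
  rcases (T.singularValues_nonneg k).eq_or_lt with h0 | h0
  · exact h0 ▸ (adjoint T).singularValues_nonneg k
  have hk : k < finrank 𝕜 E :=
    not_le.1 fun hk => h0.ne' (T.singularValues_of_finrank_le hk)
  obtain ⟨V, hV, hTV⟩ := exists_finrank_eq_forall_singularValues_mul_norm_le T hk
  have hpos {x : E} (hx : x ∈ V) (hx0 : x ≠ 0) : 0 < ‖T x‖ :=
    (mul_pos h0 (norm_pos_iff.2 hx0)).trans_le (hTV x hx)
  have hinj : Function.Injective (T.domRestrict V) := by
    refine (injective_iff_map_eq_zero _).2 fun x hx => ?_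
    by_contra hx0
    exact (hpos x.2 (by simpa using hx0)).ne' (norm_eq_zero.2 hx)
  refine le_singularValues_of_forall_mem (V.map T) ?_ ?_
  · rw [← range_domRestrict, finrank_range_of_inj hinj]
    lia
  rintro _ ⟨x, hx, rfl⟩
  rcases eq_or_ne x 0 with rfl | hx0
  · simp
  refine le_of_mul_le_mul_right ?_ (norm_pos_iff.2 hx0)
  calc T.singularValues k * ‖T x‖ * ‖x‖ = T.singularValues k * ‖x‖ * ‖T x‖ := by ring
    _ ≤ ‖T x‖ * ‖T x‖ := by gcongr; exact hTV x hx
    _ = ‖inner 𝕜 (adjoint T (T x)) x‖ := by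
      rw [adjoint_inner_left, inner_self_eq_norm_sq_to_K, norm_pow, RCLike.norm_ofReal,
        abs_norm, sq]
    _ ≤ ‖adjoint T (T x)‖ * ‖x‖ := norm_inner_le_norm _ _

theorem singularValues_adjoint (T : E →ₗ[𝕜] F) : (adjoint T).singularValues = T.singularValues := by
  ext k
  refine le_antisymm ?_ (singularValues_le_singularValues_adjoint T k)
  simpa using singularValues_le_singularValues_adjoint (adjoint T) k

end SingularValues

section Matrices

open Module Matrix

variable {p q l : ℕ}

theorem toEuclideanLin_mul (A : Matrix (Fin p) (Fin q) ℝ) (B : Matrix (Fin q) (Fin l) ℝ) :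
    (A * B).toEuclideanLin = A.toEuclideanLin ∘ₗ B.toEuclideanLin := by
  ext x : 1
  simp [toLpLin_apply]

theorem sv_nonneg (A : Matrix (Fin p) (Fin q) ℝ) (k : ℕ) : 0 ≤ sv A k :=
  LinearMap.singularValues_nonneg _ k

theorem sv_antitone (A : Matrix (Fin p) (Fin q) ℝ) : Antitone (sv A) :=
  LinearMap.singularValues_antitone _

theorem sv_eq_zero_of_rank_le (A : Matrix (Fin p) (Fin q) ℝ) {k : ℕ} (h : A.rank ≤ k) :
    sv A k = 0 := by
  rw [sv, LinearMap.singularValues_eq_zero_iff_le_finrank_range]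
  rwa [rank_eq_finrank_range_toLin A (PiLp.basisFun 2 ℝ _) (PiLp.basisFun 2 ℝ _),
    ← toLpLin_eq_toLin] at h

theorem sv_transpose (A : Matrix (Fin p) (Fin q) ℝ) : sv Aᵀ = sv A := by
  ext k
  rw [sv, ← conjTranspose_eq_transpose_of_trivial, toEuclideanLin_conjTranspose_eq_adjoint,
    singularValues_adjoint, sv]

theorem sv_add_le (A B : Matrix (Fin p) (Fin q) ℝ) (i j : ℕ) :
    sv (A + B) (i + j) ≤ sv A i + sv B j := by
  rw [sv, (toEuclideanLin (𝕜 := ℝ)).map_add]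
  exact singularValues_add_le _ _ i j

theorem sv_mul_le (A : Matrix (Fin p) (Fin q) ℝ) (B : Matrix (Fin q) (Fin l) ℝ) (i j : ℕ) :
    sv (A * B) (i + j) ≤ sv A i * sv B j := by
  rw [sv, toEuclideanLin_mul]
  exact singularValues_comp_le _ _ i j

theorem sv_mul_le_sigmaMax_mul (A : Matrix (Fin p) (Fin q) ℝ) (B : Matrix (Fin q) (Fin l) ℝ)
    (k : ℕ) : sv (A * B) k ≤ sigmaMax A * sv B k := by
  simpa [sigmaMax] using sv_mul_le A B 0 k

theorem sv_mul_le_mul_sigmaMax (A : Matrix (Fin p) (Fin q) ℝ) (B : Matrix (Fin q) (Fin l) ℝ)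
    (k : ℕ) : sv (A * B) k ≤ sv A k * sigmaMax B :=
  sv_mul_le A B k 0

theorem sigmaMax_nonneg (A : Matrix (Fin p) (Fin q) ℝ) : 0 ≤ sigmaMax A :=
  sv_nonneg A 0

theorem norm_toEuclideanLin_le (A : Matrix (Fin p) (Fin q) ℝ) (x : EuclideanSpace ℝ (Fin q)) :
    ‖A.toEuclideanLin x‖ ≤ sigmaMax A * ‖x‖ :=
  norm_apply_le_singularValues_zero_mul _ x

theorem sigmaMax_le_of_forall_norm_le {A : Matrix (Fin p) (Fin q) ℝ} {c : ℝ} (hc : 0 ≤ c)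
    (h : ∀ x, ‖A.toEuclideanLin x‖ ≤ c * ‖x‖) : sigmaMax A ≤ c :=
  singularValues_le_of_forall_mem hc ⊤ (by simp) fun x _ => h x

theorem frobenius_sq_eq_sum (A : Matrix (Fin p) (Fin q) ℝ) : ‖A‖ ^ 2 = ∑ i, ∑ j, A i j ^ 2 := by
  rw [frobenius_norm_def, ← Real.sqrt_eq_rpow, Real.sq_sqrt (by positivity)]
  simp

theorem frobenius_sq_eq_sum_col (A : Matrix (Fin p) (Fin q) ℝ) :
    ‖A‖ ^ 2 = ∑ j, ‖A.toEuclideanLin (EuclideanSpace.basisFun (Fin q) ℝ j)‖ ^ 2 := by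
  rw [frobenius_sq_eq_sum, Finset.sum_comm]
  simp [EuclideanSpace.real_norm_sq_eq]

theorem frobenius_sq_eq_sum_sv (A : Matrix (Fin p) (Fin q) ℝ) {N : ℕ} (hN : A.rank ≤ N) :
    ‖A‖ ^ 2 = ∑ i ∈ Finset.range N, sv A i ^ 2 := by
  have htail (K : ℕ) (hK : A.rank ≤ K) :
      ∑ i ∈ Finset.range A.rank, sv A i ^ 2 = ∑ i ∈ Finset.range K, sv A i ^ 2 := by
    refine Finset.sum_subset (Finset.range_mono hK) fun i _ hi => ?_
    rw [sv_eq_zero_of_rank_le A (by simpa using hi), zero_pow two_ne_zero]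
  rw [frobenius_sq_eq_sum_col, sum_sq_norm_apply_eq_sum_sq_singularValues, ← htail N hN,
    htail q (by simpa using A.rank_le_width), Finset.sum_range, finrank_euclideanSpace_fin]
  rfl

theorem sigmaMax_le_frobenius (A : Matrix (Fin p) (Fin q) ℝ) : sigmaMax A ≤ ‖A‖ := by
  refine (sq_le_sq₀ (sigmaMax_nonneg A) (norm_nonneg A)).1 ?_
  rw [frobenius_sq_eq_sum_sv A (Nat.le_succ _)]
  exact Finset.single_le_sum (f := fun i => sv A i ^ 2) (fun i _ => sq_nonneg _) (by simp)

theorem norm_mul_le_sigmaMax_mul (A : Matrix (Fin p) (Fin q) ℝ) (B : Matrix (Fin q) (Fin l) ℝ) :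
    ‖A * B‖ ≤ sigmaMax A * ‖B‖ := by
  refine (sq_le_sq₀ (norm_nonneg _) (mul_nonneg (sigmaMax_nonneg A) (norm_nonneg B))).1 ?_
  rw [mul_pow, frobenius_sq_eq_sum_col, frobenius_sq_eq_sum_col B, Finset.mul_sum]
  refine Finset.sum_le_sum fun j _ => ?_
  rw [← mul_pow, toEuclideanLin_mul]
  gcongr
  exact norm_toEuclideanLin_le A _

theorem norm_mul_le_mul_sigmaMax (A : Matrix (Fin p) (Fin q) ℝ) (B : Matrix (Fin q) (Fin l) ℝ) :
    ‖A * B‖ ≤ ‖A‖ * sigmaMax B := by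
  rw [← frobenius_norm_transpose, transpose_mul, ← frobenius_norm_transpose A, mul_comm, sigmaMax,
    ← sv_transpose]
  exact norm_mul_le_sigmaMax_mul _ _

theorem width_pos_of_sigmaMin_pos {A : Matrix (Fin p) (Fin q) ℝ} (h : 0 < sigmaMin A) : 0 < q := by
  by_contra hq
  exact h.ne' (sv_eq_zero_of_rank_le A (A.rank_le_width.trans (by lia)))

theorem norm_mul_sigmaMin_le (A : Matrix (Fin p) (Fin q) ℝ) (B : Matrix (Fin q) (Fin l) ℝ) :
    ‖A‖ * sigmaMin B ≤ ‖A * B‖ := by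
  have hmin : 0 ≤ sigmaMin B := sv_nonneg _ _
  refine (sq_le_sq₀ (mul_nonneg (norm_nonneg A) hmin) (norm_nonneg _)).1 ?_
  rw [← frobenius_norm_transpose (A * B), transpose_mul, ← frobenius_norm_transpose A, mul_comm,
    mul_pow, frobenius_sq_eq_sum_col, frobenius_sq_eq_sum_col (Bᵀ * Aᵀ), Finset.mul_sum]
  refine Finset.sum_le_sum fun j _ => ?_
  rw [← mul_pow, toEuclideanLin_mul, sigmaMin, ← sv_transpose]
  gcongr
  · exact mul_nonneg (sv_nonneg _ _) (norm_nonneg _)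
  · simpa [sv] using singularValues_pred_finrank_mul_norm_le Bᵀ.toEuclideanLin
      (Aᵀ.toEuclideanLin (EuclideanSpace.basisFun (Fin p) ℝ j))

theorem sigmaMax_le_one_of_isStarProjection {P : Matrix (Fin p) (Fin p) ℝ}
    (hP : IsStarProjection P) : sigmaMax P ≤ 1 := by
  refine sigmaMax_le_of_forall_norm_le zero_le_one fun x => ?_
  rw [← coe_toEuclideanCLM_eq_toEuclideanLin]
  exact ContinuousLinearMap.le_of_opNorm_le _
    (hP.map (toEuclideanCLM (n := Fin p) (𝕜 := ℝ))).norm_le x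

end Matrices

section BestRankOne

open Module Matrix

variable {p q : ℕ}

theorem frobenius_sq_sub_vecMulVec (A : Matrix (Fin p) (Fin q) ℝ) (b : Fin p → ℝ)
    (w : Fin q → ℝ) :
    ‖A - vecMulVec b w‖ ^ 2 = ‖A‖ ^ 2 - 2 * (b ⬝ᵥ A *ᵥ w) + (b ⬝ᵥ b) * (w ⬝ᵥ w) := by
  simp only [frobenius_sq_eq_sum, Matrix.sub_apply, vecMulVec_apply, dotProduct, mulVec]
  rw [Finset.sum_mul, Finset.mul_sum, ← Finset.sum_sub_distrib, ← Finset.sum_add_distrib]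
  refine Finset.sum_congr rfl fun i _ => ?_
  rw [Finset.mul_sum, Finset.mul_sum, Finset.mul_sum, ← Finset.sum_sub_distrib,
    ← Finset.sum_add_distrib]
  refine Finset.sum_congr rfl fun j _ => ?_
  ring

theorem frobenius_vecMulVec_self (v : Fin q → ℝ) : ‖vecMulVec v v‖ = v ⬝ᵥ v := by
  have hv : 0 ≤ v ⬝ᵥ v := dotProduct_self_star_nonneg v
  have h := frobenius_sq_sub_vecMulVec 0 v v
  simp only [zero_sub, norm_neg, zero_mulVec, dotProduct_zero, norm_zero] at h
  refine (sq_eq_sq₀ (norm_nonneg _) hv).1 ?_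
  linarith

/-- `(b, w)` is a best rank-one approximation `b wᵀ` of `A` in the Frobenius norm. -/
def IsBestRankOne (A : Matrix (Fin p) (Fin q) ℝ) (b : Fin p → ℝ) (w : Fin q → ℝ) : Prop :=
  ∀ b' w', ‖A - vecMulVec b w‖ ≤ ‖A - vecMulVec b' w'‖

/-- The matrix of the orthogonal projection onto the line spanned by `v`; it is `0` for `v = 0`. -/
noncomputable def lineProj (v : Fin q → ℝ) : Matrix (Fin q) (Fin q) ℝ :=
  (v ⬝ᵥ v)⁻¹ • vecMulVec v v

theorem isStarProjection_lineProj (v : Fin q → ℝ) : IsStarProjection (lineProj v) where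
  isIdempotentElem := by
    rcases eq_or_ne (v ⬝ᵥ v) 0 with hv | hv
    · simp [lineProj, hv, IsIdempotentElem]
    · simp [lineProj, IsIdempotentElem, vecMulVec_mul_vecMulVec, smul_smul, hv]
  isSelfAdjoint := by
    simp [lineProj, IsSelfAdjoint, star_eq_conjTranspose]

theorem frobenius_lineProj_le_one (v : Fin q → ℝ) : ‖lineProj v‖ ≤ 1 := by
  have hv : 0 ≤ v ⬝ᵥ v := dotProduct_self_star_nonneg v
  rw [lineProj, norm_smul, frobenius_vecMulVec_self, norm_inv, Real.norm_of_nonneg hv]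
  exact inv_mul_le_one

/-- The compression of `Z` to the orthogonal complements of `b` (on the left) and of `w` (on the
right): the effect of one exact deflation step in the directions `b`, `w`. -/
noncomputable def compression (b : Fin p → ℝ) (w : Fin q → ℝ) (Z : Matrix (Fin p) (Fin q) ℝ) :
    Matrix (Fin p) (Fin q) ℝ :=
  (1 - lineProj b) * Z * (1 - lineProj w)

namespace IsBestRankOne

variable {A : Matrix (Fin p) (Fin q) ℝ} {b : Fin p → ℝ} {w : Fin q → ℝ}

theorem transpose (h : IsBestRankOne A b w) : IsBestRankOne Aᵀ w b := fun w' b' => by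
  simpa only [← frobenius_norm_transpose (A - _), transpose_sub, transpose_vecMulVec] using h b' w'

theorem mulVec_eq (h : IsBestRankOne A b w) : A *ᵥ w = (w ⬝ᵥ w) • b := by
  rcases eq_or_ne w 0 with rfl | hw
  · simp
  have hω : 0 < w ⬝ᵥ w := dotProduct_self_star_pos_iff.2 hw
  set c := (w ⬝ᵥ w)⁻¹ • A *ᵥ w with hc
  have hAw : A *ᵥ w = (w ⬝ᵥ w) • c := by rw [hc, smul_inv_smul₀ hω.ne']
  have hsq : (w ⬝ᵥ w) * ((b - c) ⬝ᵥ (b - c)) =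
      ‖A - vecMulVec b w‖ ^ 2 - ‖A - vecMulVec c w‖ ^ 2 := by
    rw [frobenius_sq_sub_vecMulVec, frobenius_sq_sub_vecMulVec, hAw]
    simp only [sub_dotProduct, dotProduct_sub, dotProduct_smul, smul_eq_mul, dotProduct_comm c b]
    ring
  have hle : (w ⬝ᵥ w) * ((b - c) ⬝ᵥ (b - c)) ≤ 0 := by
    rw [hsq, sub_nonpos]
    gcongr
    exact h c w
  have hbc : (b - c) ⬝ᵥ (b - c) = 0 :=
    le_antisymm (nonpos_of_mul_nonpos_right hle hω) (dotProduct_self_star_nonneg _)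
  rw [hAw, sub_eq_zero.1 (dotProduct_self_eq_zero.1 hbc)]

theorem mul_lineProj (h : IsBestRankOne A b w) : A * lineProj w = vecMulVec b w := by
  rcases eq_or_ne w 0 with rfl | hw
  · ext i j
    simp [lineProj, vecMulVec_apply]
  · simp [lineProj, mul_vecMulVec, h.mulVec_eq, smul_vecMulVec, smul_smul, hw]

theorem lineProj_mul (h : IsBestRankOne A b w) : lineProj b * A = vecMulVec b w := by
  rw [← transpose_inj, transpose_mul, transpose_vecMulVec, ← h.transpose.mul_lineProj, lineProj,
    transpose_smul, transpose_vecMulVec]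

theorem sub_eq_compression (h : IsBestRankOne A b w) :
    A - vecMulVec b w = compression b w A := by
  have hP : lineProj b * vecMulVec b w = vecMulVec b w := by
    rw [← h.lineProj_mul, ← Matrix.mul_assoc, (isStarProjection_lineProj b).isIdempotentElem.eq]
  rw [compression, Matrix.mul_assoc, Matrix.mul_sub, Matrix.mul_one, h.mul_lineProj, Matrix.sub_mul,
    Matrix.one_mul, Matrix.mul_sub, h.lineProj_mul, hP, sub_self, sub_zero]

theorem frobenius_sq_sub_le (h : IsBestRankOne A b w) :
    ‖A - vecMulVec b w‖ ^ 2 ≤ ‖A‖ ^ 2 - sigmaMax A ^ 2 := by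
  rcases Nat.eq_zero_or_pos q with rfl | hq
  · have hA : sigmaMax A = 0 := sv_eq_zero_of_rank_le A (by simpa using A.rank_le_width)
    rw [hA, Subsingleton.elim A 0, Subsingleton.elim (vecMulVec b w) 0]
    simp
  obtain ⟨v, hv, hAv⟩ : ∃ v, ‖v‖ = 1 ∧ ‖A.toEuclideanLin v‖ = sigmaMax A :=
    ⟨rightSingularBasis A.toEuclideanLin ⟨0, by simpa using hq⟩, OrthonormalBasis.norm_eq_one _ _,
      norm_apply_rightSingularBasis _ _⟩
  have hv : v.ofLp ⬝ᵥ v.ofLp = 1 := by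
    simpa [hv, dotProduct, sq] using (EuclideanSpace.real_norm_sq_eq v).symm
  have hAv : (A *ᵥ v.ofLp) ⬝ᵥ (A *ᵥ v.ofLp) = sigmaMax A ^ 2 := by
    simpa [hAv, dotProduct, sq] using (EuclideanSpace.real_norm_sq_eq (A.toEuclideanLin v)).symm
  calc ‖A - vecMulVec b w‖ ^ 2 ≤ ‖A - vecMulVec (A *ᵥ v.ofLp) v.ofLp‖ ^ 2 := by
        gcongr
        exact h _ _
    _ = ‖A‖ ^ 2 - sigmaMax A ^ 2 := by
        rw [frobenius_sq_sub_vecMulVec, hAv, hv]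
        ring

theorem sv_succ_le_sv_sub (A : Matrix (Fin p) (Fin q) ℝ) (b : Fin p → ℝ) (w : Fin q → ℝ) (k : ℕ) :
    sv A (k + 1) ≤ sv (A - vecMulVec b w) k := by
  have h := sv_add_le (A - vecMulVec b w) (vecMulVec b w) k 1
  rwa [sub_add_cancel, sv_eq_zero_of_rank_le _ (rank_vecMulVec_le b w), add_zero] at h

theorem sv_sub_eq (h : IsBestRankOne A b w) (k : ℕ) :
    sv (A - vecMulVec b w) k = sv A (k + 1) := by
  set B := A - vecMulVec b w with hB
  obtain ⟨N, hA, hBN, hk⟩ : ∃ N, A.rank ≤ N + 1 ∧ B.rank ≤ N ∧ k < N :=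
    ⟨A.rank + B.rank + k + 1, by lia, by lia, by lia⟩
  have hle (i : ℕ) : sv A (i + 1) ^ 2 ≤ sv B i ^ 2 := by
    gcongr
    · exact sv_nonneg _ _
    · exact sv_succ_le_sv_sub A b w i
  have hsum : ∑ i ∈ Finset.range N, sv B i ^ 2 ≤ ∑ i ∈ Finset.range N, sv A (i + 1) ^ 2 := by
    have := h.frobenius_sq_sub_le
    rwa [← hB, frobenius_sq_eq_sum_sv B hBN, frobenius_sq_eq_sum_sv A hA, Finset.sum_range_succ',
      sigmaMax, add_sub_cancel_right] at this
  have hsq := (Finset.sum_eq_sum_iff_of_le fun i _ => hle i).1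
    (le_antisymm (Finset.sum_le_sum fun i _ => hle i) hsum) k (Finset.mem_range.2 hk)
  exact ((sq_eq_sq₀ (sv_nonneg _ _) (sv_nonneg _ _)).1 hsq).symm

end IsBestRankOne

end BestRankOne

section GreedySum

variable {x τ H : ℕ → ℝ} {r : ℕ}

/- The terms `x t` are charged greedily, in increasing order of `t`: after `a` charges to
`τ 0, …, τ (a - 1)` and `b` charges to `H 0, …, H (b - 1)`, the next term is charged to `τ a` if
`H b ≤ τ a` or `b = r`, and to `H b` otherwise. -/
theorem exists_sum_sq_le_of_le_add (hx : ∀ i, 0 ≤ x i) (hτ : ∀ i, 0 ≤ τ i) (hH : ∀ j, 0 ≤ H j)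
    (hlt : ∀ i, ∀ j < r, x (i + j) ≤ τ i + H j) (hr : ∀ i, x (i + r) ≤ τ i) (N : ℕ) :
    ∃ a b, a + b = N ∧ b ≤ r ∧ ∑ t ∈ Finset.range N, x t ^ 2 ≤
      ∑ i ∈ Finset.range a, (τ i ^ 2 + 3 * (∑ j ∈ Finset.range r, H j) * τ i) +
        ∑ j ∈ Finset.range b, (2 * H j) ^ 2 := by
  induction N with
  | zero => exact ⟨0, 0, by simp⟩
  | succ N ih =>
    obtain ⟨a, b, rfl, hb, hsum⟩ := ih
    set S := ∑ j ∈ Finset.range r, H j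
    have hS : 0 ≤ S := Finset.sum_nonneg fun j _ => hH j
    have hxab := hx (a + b)
    rcases hb.eq_or_lt with rfl | hbr
    · refine ⟨a + 1, b, by lia, le_rfl, ?_⟩
      rw [Finset.sum_range_succ, Finset.sum_range_succ _ a]
      have hsq : x (a + b) ^ 2 ≤ τ a ^ 2 := by gcongr; exact hr a
      linarith [mul_nonneg hS (hτ a)]
    have hle := hlt a b hbr
    by_cases hc : H b ≤ τ a
    · refine ⟨a + 1, b, by lia, hb, ?_⟩
      rw [Finset.sum_range_succ, Finset.sum_range_succ _ a]
      have hHS : H b ≤ S :=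
        Finset.single_le_sum (fun j _ => hH j) (Finset.mem_range.2 hbr)
      have hsq : x (a + b) ^ 2 ≤ (τ a + H b) ^ 2 := by gcongr
      have hself : H b * H b ≤ S * τ a := mul_le_mul hHS hc (hH b) hS
      have hcross : H b * τ a ≤ S * τ a := mul_le_mul_of_nonneg_right hHS (hτ a)
      linarith [add_sq (τ a) (H b), sq (H b)]
    · refine ⟨a, b + 1, by lia, hbr, ?_⟩
      rw [Finset.sum_range_succ, Finset.sum_range_succ _ b]
      have hsq : x (a + b) ^ 2 ≤ (2 * H b) ^ 2 := by
        gcongr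
        linarith
      linarith

theorem sum_sq_le_sq_sum_add (hx : ∀ i, 0 ≤ x i) (hτ : ∀ i, 0 ≤ τ i) (hH : ∀ j, 0 ≤ H j)
    (hlt : ∀ i, ∀ j < r, x (i + j) ≤ τ i + H j) (hr : ∀ i, x (i + r) ≤ τ i) (N : ℕ) :
    ∑ t ∈ Finset.range N, x t ^ 2 ≤
      (∑ i ∈ Finset.range N, τ i + 2 * ∑ j ∈ Finset.range r, H j) ^ 2 := by
  obtain ⟨a, b, rfl, hb, hsum⟩ := exists_sum_sq_le_of_le_add hx hτ hH hlt hr N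
  set S := ∑ j ∈ Finset.range r, H j
  set T := ∑ i ∈ Finset.range a, τ i
  have hS : 0 ≤ S := Finset.sum_nonneg fun j _ => hH j
  have hT : 0 ≤ T := Finset.sum_nonneg fun i _ => hτ i
  have hTsq : ∑ i ∈ Finset.range a, τ i ^ 2 ≤ T ^ 2 :=
    Finset.sum_sq_le_sq_sum_of_nonneg fun i _ => hτ i
  have hSsq : ∑ j ∈ Finset.range b, (2 * H j) ^ 2 ≤ (2 * S) ^ 2 := by
    refine (Finset.sum_sq_le_sq_sum_of_nonneg fun j _ => mul_nonneg two_pos.le (hH j)).trans ?_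
    rw [← Finset.mul_sum]
    gcongr
    · exact mul_nonneg two_pos.le (Finset.sum_nonneg fun j _ => hH j)
    · exact Finset.sum_le_sum_of_subset_of_nonneg (Finset.range_mono hb) fun j _ _ => hH j
  calc ∑ t ∈ Finset.range (a + b), x t ^ 2
      ≤ T ^ 2 + 3 * S * T + (2 * S) ^ 2 := by
        rw [Finset.sum_add_distrib, ← Finset.mul_sum] at hsum
        linarith
    _ ≤ (T + 2 * S) ^ 2 := by linarith [mul_nonneg hS hT, add_sq T (2 * S)]
    _ ≤ (∑ i ∈ Finset.range (a + b), τ i + 2 * S) ^ 2 := by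
        gcongr
        exact Finset.sum_le_sum_of_subset_of_nonneg (Finset.range_mono (by lia)) fun i _ _ => hτ i

end GreedySum

section LinearError

/-- The accumulated numerical error of `r` steps when no spectral gap is available: the error `e l`
of step `l` enters once, and again with weight `4` at each later step. -/
def linearError (e : ℕ → ℝ) (r : ℕ) : ℝ :=
  ∑ k ∈ Finset.range r, (e k + 4 * ∑ l ∈ Finset.range k, e l)

theorem linearError_mono {e f : ℕ → ℝ} (h : ∀ k, e k ≤ f k) (r : ℕ) :
    linearError e r ≤ linearError f r :=
  Finset.sum_le_sum fun k _ => by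
    gcongr
    · exact h k
    · exact h _

theorem linearError_const_mul (c : ℝ) (e : ℕ → ℝ) (r : ℕ) :
    linearError (fun k => c * e k) r = c * linearError e r := by
  simp only [linearError, ← Finset.mul_sum]
  rw [Finset.mul_sum]
  exact Finset.sum_congr rfl fun k _ => by ring

end LinearError

section Compression

open Matrix

variable {p q : ℕ}

theorem sigmaMax_neg (A : Matrix (Fin p) (Fin q) ℝ) : sigmaMax (-A) = sigmaMax A := by
  have hle (B : Matrix (Fin p) (Fin q) ℝ) : sigmaMax (-B) ≤ sigmaMax B :=
    sigmaMax_le_of_forall_norm_le (sigmaMax_nonneg B) fun x => by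
      simpa using norm_toEuclideanLin_le B x
  exact (hle A).antisymm (by simpa using hle (-A))

theorem sv_le_sv_add_sigmaMax_sub (A B : Matrix (Fin p) (Fin q) ℝ) (k : ℕ) :
    sv A k ≤ sv B k + sigmaMax (A - B) := by
  simpa [sigmaMax] using sv_add_le B (A - B) k 0

theorem sv_le_sv_add_norm_sub (A B : Matrix (Fin p) (Fin q) ℝ) (k : ℕ) :
    sv A k ≤ sv B k + ‖A - B‖ := by
  grw [sv_le_sv_add_sigmaMax_sub A B k, sigmaMax_le_frobenius]

theorem sigmaMax_one_sub_lineProj_le_one (v : Fin p → ℝ) : sigmaMax (1 - lineProj v) ≤ 1 :=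
  sigmaMax_le_one_of_isStarProjection (isStarProjection_lineProj v).one_sub

section

variable (b : Fin p → ℝ) (w : Fin q → ℝ) (Z : Matrix (Fin p) (Fin q) ℝ)

theorem compression_add (Z' : Matrix (Fin p) (Fin q) ℝ) :
    compression b w (Z + Z') = compression b w Z + compression b w Z' := by
  simp only [compression, Matrix.mul_add, Matrix.add_mul]

theorem compression_sub (Z' : Matrix (Fin p) (Fin q) ℝ) :
    compression b w (Z - Z') = compression b w Z - compression b w Z' := by
  simp only [compression, Matrix.mul_sub (1 - lineProj b), Matrix.sub_mul _ _ (1 - lineProj w)]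

theorem sv_compression_le (k : ℕ) : sv (compression b w Z) k ≤ sv Z k := by
  have hZ := sv_nonneg Z k
  have hbZ := sv_nonneg ((1 - lineProj b) * Z) k
  grw [compression, sv_mul_le_mul_sigmaMax, sigmaMax_one_sub_lineProj_le_one, mul_one,
    sv_mul_le_sigmaMax_mul, sigmaMax_one_sub_lineProj_le_one, one_mul]

theorem norm_compression_le : ‖compression b w Z‖ ≤ ‖Z‖ := by
  grw [compression, norm_mul_le_mul_sigmaMax, sigmaMax_one_sub_lineProj_le_one, mul_one,
    norm_mul_le_sigmaMax_mul, sigmaMax_one_sub_lineProj_le_one, one_mul]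

theorem norm_sub_compression_le : ‖Z - compression b w Z‖ ≤ 2 * sigmaMax Z := by
  have hsplit : Z - compression b w Z = lineProj b * Z + (1 - lineProj b) * (Z * lineProj w) := by
    rw [compression, Matrix.mul_sub, Matrix.mul_one, Matrix.mul_assoc, Matrix.sub_mul,
      Matrix.one_mul]
    abel
  have hZ := sigmaMax_nonneg Z
  rw [hsplit, two_mul]
  refine (norm_add_le _ _).trans (add_le_add ?_ ?_)
  · grw [norm_mul_le_mul_sigmaMax, frobenius_lineProj_le_one, one_mul]
  · grw [norm_mul_le_sigmaMax_mul, sigmaMax_one_sub_lineProj_le_one, one_mul,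
      norm_mul_le_sigmaMax_mul, frobenius_lineProj_le_one, mul_one]

end

/-- The compression of `Z` along `b 0, w 0`, then along `b 1, w 1`, …, up to `b (k - 1), w (k - 1)`.
Deflation with additive errors acts like this, up to those errors, on each summand of the deflated
matrix, which lets signal and noise be estimated separately. -/
noncomputable def iterCompression (b : ℕ → Fin p → ℝ) (w : ℕ → Fin q → ℝ)
    (Z : Matrix (Fin p) (Fin q) ℝ) : ℕ → Matrix (Fin p) (Fin q) ℝ
  | 0 => Z
  | k + 1 => compression (b k) (w k) (iterCompression b w Z k)

section

variable (b : ℕ → Fin p → ℝ) (w : ℕ → Fin q → ℝ)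

theorem iterCompression_add (M E : Matrix (Fin p) (Fin q) ℝ) (k : ℕ) :
    iterCompression b w (M + E) k = iterCompression b w M k + iterCompression b w E k := by
  induction k with
  | zero => rfl
  | succ k ih => simp only [iterCompression, ih, compression_add]

theorem sv_iterCompression_anti (Z : Matrix (Fin p) (Fin q) ℝ) (i : ℕ) {j k : ℕ} (hjk : j ≤ k) :
    sv (iterCompression b w Z k) i ≤ sv (iterCompression b w Z j) i :=
  antitone_nat_of_succ_le (f := fun k => sv (iterCompression b w Z k) i)
    (fun k => sv_compression_le (b k) (w k) _ i) hjk

theorem sv_iterCompression_le (Z : Matrix (Fin p) (Fin q) ℝ) (i k : ℕ) :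
    sv (iterCompression b w Z k) i ≤ sv Z i := by
  simpa only [iterCompression] using sv_iterCompression_anti b w Z i (Nat.zero_le k)

theorem sigmaMax_iterCompression_le (Z : Matrix (Fin p) (Fin q) ℝ) (k : ℕ) :
    sigmaMax (iterCompression b w Z k) ≤ sigmaMax Z :=
  sv_iterCompression_le b w Z 0 k

theorem norm_sub_iterCompression_le (Z : Matrix (Fin p) (Fin q) ℝ) (k : ℕ) :
    ‖Z - iterCompression b w Z k‖ ≤ 2 * k * sigmaMax Z := by
  induction k with
  | zero => simp [iterCompression]
  | succ k ih =>
    have hstep := norm_sub_compression_le (b k) (w k) (iterCompression b w Z k)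
    grw [sigmaMax_iterCompression_le] at hstep
    grw [norm_sub_le_norm_sub_add_norm_sub _ (iterCompression b w Z k), ih, iterCompression, hstep]
    push_cast
    linarith

end

end Compression

section InexactDeflation

open Matrix

variable {p q : ℕ}

/-- `A 0, …, A r` is produced by `r` steps of deflation, each of which subtracts a best rank-one
approximation `b k (w k)ᵀ` of `A k` together with an error `Δ k`. -/
structure IsInexactDeflation (A Δ : ℕ → Matrix (Fin p) (Fin q) ℝ) (b : ℕ → Fin p → ℝ)
    (w : ℕ → Fin q → ℝ) (r : ℕ) : Prop where
  isBestRankOne : ∀ k < r, IsBestRankOne (A k) (b k) (w k)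
  succ_eq : ∀ k < r, A (k + 1) = A k - vecMulVec (b k) (w k) - Δ k

namespace IsInexactDeflation

variable {A Δ : ℕ → Matrix (Fin p) (Fin q) ℝ} {b : ℕ → Fin p → ℝ} {w : ℕ → Fin q → ℝ} {r k : ℕ}

theorem succ_eq_compression_sub (h : IsInexactDeflation A Δ b w r) (hk : k < r) :
    A (k + 1) = compression (b k) (w k) (A k) - Δ k := by
  rw [h.succ_eq k hk, (h.isBestRankOne k hk).sub_eq_compression]

theorem sv_compression_eq (h : IsInexactDeflation A Δ b w r) (hk : k < r) (i : ℕ) :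
    sv (compression (b k) (w k) (A k)) i = sv (A k) (i + 1) := by
  rw [← (h.isBestRankOne k hk).sub_eq_compression, (h.isBestRankOne k hk).sv_sub_eq]

theorem norm_iterCompression_sub_le (h : IsInexactDeflation A Δ b w r) (hk : k ≤ r) :
    ‖iterCompression b w (A 0) k - A k‖ ≤ ∑ l ∈ Finset.range k, ‖Δ l‖ := by
  induction k with
  | zero => simp [iterCompression]
  | succ k ih =>
    rw [Finset.sum_range_succ, h.succ_eq_compression_sub hk, iterCompression, ← sub_add,
      ← compression_sub]
    grw [norm_add_le, norm_compression_le, ih (by lia)]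

theorem sv_le (h : IsInexactDeflation A Δ b w r) (hk : k ≤ r) (i : ℕ) :
    sv (A k) i ≤ sv (A 0) (i + k) + ∑ l ∈ Finset.range k, ‖Δ l‖ := by
  induction k generalizing i with
  | zero => simp
  | succ k ih =>
    have hΔ : A (k + 1) - compression (b k) (w k) (A k) = -Δ k := by
      rw [h.succ_eq_compression_sub hk, sub_sub_cancel_left]
    grw [sv_le_sv_add_norm_sub (A (k + 1)) (compression (b k) (w k) (A k)), hΔ, norm_neg,
      h.sv_compression_eq hk, ih (by lia), Finset.sum_range_succ, add_assoc, add_right_comm i 1 k,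
      add_assoc i]

theorem sv_iterCompression_succ_le (h : IsInexactDeflation A Δ b w r) (hk : k < r) (i : ℕ) :
    sv (iterCompression b w (A 0) (k + 1)) i ≤
      sv (A 0) (i + (k + 1)) + 2 * ∑ l ∈ Finset.range k, ‖Δ l‖ := by
  grw [sv_le_sv_add_norm_sub _ (compression (b k) (w k) (A k)), iterCompression, ← compression_sub,
    norm_compression_le, h.norm_iterCompression_sub_le hk.le, h.sv_compression_eq hk,
    h.sv_le hk.le, add_right_comm i 1 k, add_assoc i, two_mul, add_assoc]

variable {M E : Matrix (Fin p) (Fin q) ℝ}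

theorem sv_iterCompression_signal_le (h : IsInexactDeflation A Δ b w r) (h0 : A 0 = M + E)
    (hk : k < r) (i : ℕ) :
    sv (iterCompression b w M (k + 1)) i ≤
      sv M (i + (k + 1)) + (2 * sigmaMax E + 2 * ∑ l ∈ Finset.range k, ‖Δ l‖) := by
  have hsub : iterCompression b w M (k + 1) - iterCompression b w (A 0) (k + 1) =
      -iterCompression b w E (k + 1) := by
    rw [h0, iterCompression_add, sub_add_cancel_left]
  have hA0 := sv_le_sv_add_sigmaMax_sub (A 0) M (i + (k + 1))
  rw [h0, add_sub_cancel_left, ← h0] at hA0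
  grw [sv_le_sv_add_sigmaMax_sub _ (iterCompression b w (A 0) (k + 1)), hsub, sigmaMax_neg,
    sigmaMax_iterCompression_le, h.sv_iterCompression_succ_le hk, hA0]
  linarith

theorem norm_iterCompression_signal_le (h : IsInexactDeflation A Δ b w r) (h0 : A 0 = M + E) :
    ‖iterCompression b w M r‖ ≤ ∑ i ∈ Finset.range q, sv M (r + i) +
      4 * (r * sigmaMax E + ∑ k ∈ Finset.range r, ∑ l ∈ Finset.range k, ‖Δ l‖) := by
  set G : ℕ → ℝ := fun k => ∑ l ∈ Finset.range k, ‖Δ l‖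
  have hG0 (k : ℕ) : 0 ≤ G k := Finset.sum_nonneg fun _ _ => norm_nonneg _
  set H : ℕ → ℝ := fun j => 2 * sigmaMax E + 2 * G (r - 1 - j) with hH
  have hH0 (j : ℕ) : 0 ≤ H j := by
    have := hG0 (r - 1 - j)
    have := sigmaMax_nonneg E
    positivity
  have hHsum : ∑ j ∈ Finset.range r, H j = 2 * (r * sigmaMax E + ∑ k ∈ Finset.range r, G k) := by
    rw [Finset.sum_add_distrib, ← Finset.mul_sum _ (fun j => G (r - 1 - j)),
      Finset.sum_range_reflect, Finset.sum_const, Finset.card_range, nsmul_eq_mul]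
    ring
  have hlt (i j : ℕ) (hj : j < r) : sv (iterCompression b w M r) (i + j) ≤ sv M (r + i) + H j := by
    obtain ⟨k, rfl⟩ := Nat.exists_eq_add_of_lt hj
    have hbound := h.sv_iterCompression_signal_le h0 (k := k) (by lia) (i + j)
    have hanti := sv_iterCompression_anti b w M (i + j) (show k + 1 ≤ j + k + 1 by lia)
    simp only [hH, show j + k + 1 - 1 - j = k by lia, show j + k + 1 + i = i + j + (k + 1) by lia]
    exact hanti.trans hbound
  have hr (i : ℕ) : sv (iterCompression b w M r) (i + r) ≤ sv M (r + i) := by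
    rw [add_comm r i]
    exact sv_iterCompression_le b w M (i + r) r
  have hq : (iterCompression b w M r).rank ≤ q := by simpa using rank_le_width _
  refine (sq_le_sq₀ (norm_nonneg _) ?_).1 ?_
  · have := Finset.sum_nonneg fun j (_ : j ∈ Finset.range r) => hH0 j
    have := Finset.sum_nonneg fun i (_ : i ∈ Finset.range q) => sv_nonneg M (r + i)
    linarith
  · rw [frobenius_sq_eq_sum_sv _ hq]
    refine (sum_sq_le_sq_sum_add (sv_nonneg _) (fun i => sv_nonneg _ _) hH0 hlt hr q).trans_eq ?_
    rw [hHsum]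
    ring

theorem norm_sub_noise_le (h : IsInexactDeflation A Δ b w r) (h0 : A 0 = M + E) :
    ‖A r - E‖ ≤ ∑ i ∈ Finset.range q, sv M (r + i) +
      linearError (fun k => ‖Δ k‖) r + 6 * r * sigmaMax E := by
  have hsplit : A r - E = iterCompression b w M r - (iterCompression b w (A 0) r - A r) -
      (E - iterCompression b w E r) := by
    rw [h0, iterCompression_add]
    abel
  rw [hsplit]
  refine (norm_sub_le _ _).trans ?_
  grw [norm_sub_le, h.norm_iterCompression_signal_le h0, h.norm_iterCompression_sub_le le_rfl,
    norm_sub_iterCompression_le, linearError, Finset.sum_add_distrib, ← Finset.mul_sum]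
  linarith

end IsInexactDeflation

end InexactDeflation

section RowSpace

open Matrix

variable {p q : ℕ} {P : Matrix (Fin q) (Fin q) ℝ}

theorem transpose_eq_of_isStarProjection (hP : IsStarProjection P) : Pᵀ = P := by
  rw [← conjTranspose_eq_transpose_of_trivial]
  exact hP.isSelfAdjoint

theorem frobenius_sq_eq_trace (A : Matrix (Fin p) (Fin q) ℝ) : ‖A‖ ^ 2 = (A * Aᵀ).trace := by
  rw [frobenius_sq_eq_sum]
  simp [trace, mul_apply, sq]

theorem frobenius_sq_eq_add_of_isStarProjection (hP : IsStarProjection P)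
    (A : Matrix (Fin p) (Fin q) ℝ) : ‖A‖ ^ 2 = ‖A * P‖ ^ 2 + ‖A * (1 - P)‖ ^ 2 := by
  have hsq {R : Matrix (Fin q) (Fin q) ℝ} (hR : IsStarProjection R) :
      ‖A * R‖ ^ 2 = (A * R * Aᵀ).trace := by
    rw [frobenius_sq_eq_trace, transpose_mul, transpose_eq_of_isStarProjection hR,
      Matrix.mul_assoc, ← Matrix.mul_assoc R, hR.isIdempotentElem.eq, Matrix.mul_assoc]
  rw [hsq hP, hsq hP.one_sub, ← trace_add, ← Matrix.add_mul, ← Matrix.mul_add, add_sub_cancel,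
    Matrix.mul_one, frobenius_sq_eq_trace]

/-- The matrix of the orthogonal projection onto the row space of `X`. -/
noncomputable def rowProj (X : Matrix (Fin p) (Fin q) ℝ) : Matrix (Fin q) (Fin q) ℝ :=
  (toEuclideanCLM (𝕜 := ℝ)).symm (LinearMap.range Xᵀ.toEuclideanLin).starProjection

variable (X : Matrix (Fin p) (Fin q) ℝ)

theorem isStarProjection_rowProj : IsStarProjection (rowProj X) where
  isIdempotentElem := by
    rw [IsIdempotentElem, rowProj, ← map_mul, isStarProjection_starProjection.isIdempotentElem.eq]
  isSelfAdjoint := by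
    exact ((toEuclideanCLM (𝕜 := ℝ)).symm.map_star' _).symm.trans
      (congrArg _ isStarProjection_starProjection.isSelfAdjoint)

theorem toEuclideanLin_rowProj (x : EuclideanSpace ℝ (Fin q)) :
    (rowProj X).toEuclideanLin x = (LinearMap.range Xᵀ.toEuclideanLin).starProjection x := by
  rw [← coe_toEuclideanCLM_eq_toEuclideanLin, rowProj, StarAlgEquiv.apply_symm_apply]
  rfl

theorem mul_rowProj : X * rowProj X = X := by
  rw [← transpose_inj, transpose_mul, transpose_eq_of_isStarProjection (isStarProjection_rowProj X)]
  refine toEuclideanLin.injective (LinearMap.ext fun x => ?_)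
  rw [toEuclideanLin_mul, LinearMap.comp_apply, toEuclideanLin_rowProj]
  exact Submodule.starProjection_eq_self_iff.2 (LinearMap.mem_range_self _ x)

theorem exists_vecMul_eq_vecMul_rowProj (w : Fin q → ℝ) : ∃ a, a ᵥ* X = w ᵥ* rowProj X := by
  obtain ⟨a, ha⟩ := Submodule.starProjection_apply_mem (LinearMap.range Xᵀ.toEuclideanLin)
    (WithLp.toLp 2 w)
  rw [← toEuclideanLin_rowProj] at ha
  refine ⟨a.ofLp, ?_⟩
  rw [← mulVec_transpose, ← mulVec_transpose,
    transpose_eq_of_isStarProjection (isStarProjection_rowProj X)]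
  exact congrArg WithLp.ofLp ha

end RowSpace

section SequentialAlgorithm

open Matrix

variable {m d n : ℕ} {X : Matrix (Fin d) (Fin n) ℝ}

theorem outer_mul (ab : (Fin d → ℝ) × (Fin m → ℝ)) (X : Matrix (Fin d) (Fin n) ℝ) :
    outer ab * X = vecMulVec ab.2 (ab.1 ᵥ* X) :=
  vecMulVec_mul _ _ _

theorem IsExactRank1.isBestRankOne {Y : Matrix (Fin m) (Fin n) ℝ}
    {ab : (Fin d → ℝ) × (Fin m → ℝ)} (h : IsExactRank1 X Y ab) :
    IsBestRankOne (Y * rowProj X) ab.2 (ab.1 ᵥ* X) := by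
  intro b w
  have hP := isStarProjection_rowProj X
  obtain ⟨a, ha⟩ := exists_vecMul_eq_vecMul_rowProj X w
  have hpyth (ab' : (Fin d → ℝ) × (Fin m → ℝ)) : ‖Y - outer ab' * X‖ ^ 2 =
      ‖Y * rowProj X - outer ab' * X‖ ^ 2 + ‖Y * (1 - rowProj X)‖ ^ 2 := by
    rw [frobenius_sq_eq_add_of_isStarProjection hP, Matrix.sub_mul, Matrix.mul_assoc _ X,
      mul_rowProj, Matrix.sub_mul, Matrix.mul_sub (outer ab' * X), Matrix.mul_one,
      Matrix.mul_assoc _ X, mul_rowProj, sub_self, sub_zero]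
  have hle : ‖Y * rowProj X - outer ab * X‖ ≤ ‖Y * rowProj X - outer (a, b) * X‖ := by
    have := h (a, b)
    rw [hpyth, hpyth] at this
    exact (sq_le_sq₀ (norm_nonneg _) (norm_nonneg _)).1 (by linarith)
  have hfactor : Y * rowProj X - outer (a, b) * X =
      (Y * rowProj X - vecMulVec b w) * rowProj X := by
    rw [outer_mul, ha, Matrix.sub_mul, Matrix.mul_assoc Y, hP.isIdempotentElem.eq, vecMulVec_mul]
  rw [outer_mul] at hle
  grw [hle, hfactor, norm_mul_le_mul_sigmaMax, sigmaMax_le_one_of_isStarProjection hP, mul_one]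

theorem deflated_eq (rank1 : ℕ → Rank1Routine m d n) (X : Matrix (Fin d) (Fin n) ℝ) (t : ℕ)
    (Y : Matrix (Fin m) (Fin n) ℝ) (k : ℕ) :
    deflated rank1 X t Y k = Y - (∑ l ∈ Finset.range k, outer (output rank1 X t Y l)) * X := by
  induction k with
  | zero => simp [deflated]
  | succ k ih =>
    rw [Finset.sum_range_succ, Matrix.add_mul, ← sub_sub, ← ih]
    rfl

theorem isInexactDeflation_deflated {rank1 : ℕ → Rank1Routine m d n} {t r : ℕ}
    {Y : Matrix (Fin m) (Fin n) ℝ} {exact : ℕ → (Fin d → ℝ) × (Fin m → ℝ)}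
    (h : ∀ k < r, IsExactRank1 X (deflated rank1 X t Y k) (exact k)) :
    IsInexactDeflation (fun k => deflated rank1 X t Y k * rowProj X)
      (fun k => (outer (output rank1 X t Y k) - outer (exact k)) * X)
      (fun k => (exact k).2) (fun k => (exact k).1 ᵥ* X) r where
  isBestRankOne k hk := (h k hk).isBestRankOne
  succ_eq k _ := by
    change (deflated rank1 X t Y k - outer (output rank1 X t Y k) * X) * rowProj X = _
    rw [Matrix.sub_mul, Matrix.mul_assoc _ X, mul_rowProj, Matrix.sub_mul,
      outer_mul (exact k), sub_sub, add_sub_cancel]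

theorem sum_range_sv_add_le (W : Matrix (Fin m) (Fin d) ℝ) (r N : ℕ) :
    ∑ i ∈ Finset.range N, sv W (r + i) ≤ ∑ k ∈ Finset.Ico r W.rank, sv W k := by
  have hshift : ∑ i ∈ Finset.range N, sv W (r + i) = ∑ k ∈ Finset.Ico r (r + N), sv W k := by
    rw [Finset.sum_Ico_eq_sum_range, Nat.add_sub_cancel_left]
  rw [hshift]
  calc ∑ k ∈ Finset.Ico r (r + N), sv W k
      ≤ ∑ k ∈ Finset.Ico r (max (r + N) W.rank), sv W k :=
        Finset.sum_le_sum_of_subset_of_nonneg (Finset.Ico_subset_Ico_right (le_max_left _ _))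
          fun i _ _ => sv_nonneg W i
    _ = ∑ k ∈ Finset.Ico r W.rank, sv W k := by
        refine (Finset.sum_subset (Finset.Ico_subset_Ico_right (le_max_right _ _))
          fun i hi hi' => sv_eq_zero_of_rank_le W ?_).symm
        simp only [Finset.mem_Ico] at hi hi'
        lia

theorem norm_sub_sum_outer_le (hX : 0 < sigmaMin X) {W : Matrix (Fin m) (Fin d) ℝ}
    {E Y : Matrix (Fin m) (Fin n) ℝ} (hY : Y = W * X + E) {r : ℕ}
    {rank1 : ℕ → Rank1Routine m d n} {t : ℕ} {exact : ℕ → (Fin d → ℝ) × (Fin m → ℝ)}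
    (hexact : ∀ k < r, IsExactRank1 X (deflated rank1 X t Y k) (exact k)) :
    ‖W - ∑ k ∈ Finset.range r, outer (output rank1 X t Y k)‖ ≤
      cond X * (∑ k ∈ Finset.Ico r W.rank, sv W k +
        linearError (fun k => ‖outer (output rank1 X t Y k) - outer (exact k)‖) r) +
        6 * r * sigmaMax E / sigmaMin X := by
  set D := W - ∑ k ∈ Finset.range r, outer (output rank1 X t Y k)
  have hmax := sigmaMax_nonneg X
  have hE := sigmaMax_nonneg E
  have hstart : deflated rank1 X t Y 0 * rowProj X = W * X + E * rowProj X := by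
    rw [deflated, hY, Matrix.add_mul, Matrix.mul_assoc, mul_rowProj]
  have hend : deflated rank1 X t Y r * rowProj X - E * rowProj X = D * X := by
    have hsub : deflated rank1 X t Y r - E = D * X := by
      rw [deflated_eq, Matrix.sub_mul, sub_right_comm, sub_left_inj, sub_eq_iff_eq_add, hY]
    rw [← Matrix.sub_mul, hsub, Matrix.mul_assoc, mul_rowProj]
  have hdefl := (isInexactDeflation_deflated hexact).norm_sub_noise_le hstart
  simp only [hend] at hdefl
  have htail : ∑ i ∈ Finset.range n, sv (W * X) (r + i) ≤
      sigmaMax X * ∑ k ∈ Finset.Ico r W.rank, sv W k := by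
    grw [← sum_range_sv_add_le W r n, Finset.mul_sum]
    refine Finset.sum_le_sum fun i _ => ?_
    grw [sv_mul_le_mul_sigmaMax, mul_comm]
  have herr := linearError_mono (fun k =>
    (norm_mul_le_mul_sigmaMax (outer (output rank1 X t Y k) - outer (exact k)) X).trans_eq
      (mul_comm _ _)) r
  rw [linearError_const_mul] at herr
  have hnoise : sigmaMax (E * rowProj X) ≤ sigmaMax E := by
    have hP := sigmaMax_le_one_of_isStarProjection (isStarProjection_rowProj X)
    exact (sv_mul_le_mul_sigmaMax E _ 0).trans (mul_le_of_le_one_right hE hP)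
  rw [cond, div_mul_eq_mul_div, ← add_div, le_div_iff₀ hX]
  grw [norm_mul_sigmaMin_le, hdefl, htail, herr, hnoise, mul_add]

end SequentialAlgorithm

section SpectralGap

variable {m n : ℕ} {Y : Matrix (Fin m) (Fin n) ℝ}

theorem gap_le_sv (Y : Matrix (Fin m) (Fin n) ℝ) {j k : ℕ} (hjk : j ≤ k) : gap Y k ≤ sv Y j :=
  (min_le_right _ _).trans (sv_antitone Y hjk)

theorem gap_pos_of_gapMin_pos {r k : ℕ} (h : 0 < gapMin Y r) (hk : k < r) : 0 < gap Y k :=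
  h.trans_le (ciInf_le (Set.finite_range _).bddBelow (⟨k, hk⟩ : Fin r))

theorem eight_le_prod_gap_ratio {k l : ℕ} (h : 0 < gap Y k) (hlk : l < k) :
    8 ≤ ∏ j ∈ Finset.Ioc l k, (2 + 6 * sv Y j / gap Y k) := by
  have hfac (j : ℕ) (hj : j ∈ Finset.Ioc l k) : 8 ≤ 2 + 6 * sv Y j / gap Y k := by
    have : 6 ≤ 6 * sv Y j / gap Y k := by
      rw [le_div_iff₀ h]
      linarith [gap_le_sv Y (Finset.mem_Ioc.1 hj).2]
    linarith
  calc (8 : ℝ) ≤ 8 ^ (Finset.Ioc l k).card := by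
        refine le_self_pow₀ (by norm_num) ?_
        rw [Nat.card_Ioc]
        lia
    _ = ∏ _j ∈ Finset.Ioc l k, (8 : ℝ) := by rw [Finset.prod_const]
    _ ≤ ∏ j ∈ Finset.Ioc l k, (2 + 6 * sv Y j / gap Y k) :=
        Finset.prod_le_prod (fun _ _ => by norm_num) hfac

theorem linearError_le_accumulatedError {r : ℕ} (h : 0 < gapMin Y r) {e : ℕ → ℝ}
    (he : ∀ k, 0 ≤ e k) : linearError e r ≤ accumulatedError Y e r := by
  refine Finset.sum_le_sum fun k hk => ?_
  have hgap := gap_pos_of_gapMin_pos h (Finset.mem_range.1 hk)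
  rw [Finset.sum_range_succ, Finset.Ioc_self, Finset.prod_empty, mul_one, add_comm,
    Finset.mul_sum]
  gcongr (∑ l ∈ Finset.range k, ?_) + e k with l hl
  rw [mul_comm]
  exact mul_le_mul_of_nonneg_left
    (by linarith [eight_le_prod_gap_ratio hgap (Finset.mem_range.1 hl)]) (he l)

end SpectralGap

section Nets

open Metric Module

variable {F : Type*} [NormedAddCommGroup F]

theorem packingNumber_closedBall_two_le (F : Type*) [NormedAddCommGroup F] [NormedSpace ℝ F]
    [FiniteDimensional ℝ F] : packingNumber 1 (closedBall (0 : F) 2) ≤ 5 ^ finrank ℝ F := by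
  refine iSup₂_le fun C hC => iSup_le fun hsep => ?_
  by_contra! hlt
  obtain ⟨t, htC, ht⟩ := Set.exists_subset_encard_eq (Order.add_one_le_of_lt hlt)
  have hfin : t.Finite := Set.finite_of_encard_eq_coe (k := 5 ^ finrank ℝ F + 1) (mod_cast ht)
  lift t to Finset F using hfin
  have hcard := Besicovitch.card_le_of_separated t
    (fun c hc => mem_closedBall_zero_iff.1 (hC (htC hc)))
    fun c hc c' hc' hne => by
      have : ((1 : ℝ≥0) : ENNReal) < edist c c' := hsep (htC hc) (htC hc') hne
      rw [edist_dist, ENNReal.coe_one, ENNReal.one_lt_ofReal, dist_eq_norm] at this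
      exact this.le
  rw [Set.encard_coe_eq_coe_finsetCard] at ht
  norm_cast at ht
  lia

theorem exists_finset_isCover_closedBall_two (F : Type*) [NormedAddCommGroup F] [NormedSpace ℝ F]
    [FiniteDimensional ℝ F] :
    ∃ s : Finset F, s.card ≤ 5 ^ finrank ℝ F ∧ (∀ c ∈ s, ‖c‖ ≤ 2) ∧
      IsCover 1 (closedBall (0 : F) 2) s := by
  set s := maximalSeparatedSet 1 (closedBall (0 : F) 2)
  have hle := packingNumber_closedBall_two_le F
  have hpack : packingNumber 1 (closedBall (0 : F) 2) ≠ ⊤ :=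
    (hle.trans_lt (mod_cast ENat.natCast_lt_top (5 ^ finrank ℝ F))).ne
  have hcover : IsCover 1 (closedBall (0 : F) 2) s := isCover_maximalSeparatedSet hpack
  have hball : s ⊆ closedBall (0 : F) 2 := maximalSeparatedSet_subset
  rw [← encard_maximalSeparatedSet hpack, show maximalSeparatedSet 1 _ = s from rfl] at hle
  have hfin : s.Finite := Set.finite_of_encard_le_coe (k := 5 ^ finrank ℝ F) (mod_cast hle)
  lift s to Finset F using hfin with s₀
  rw [Set.encard_coe_eq_coe_finsetCard] at hle
  exact ⟨s₀, mod_cast hle, fun c hc => mem_closedBall_zero_iff.1 (hball hc), hcover⟩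

theorem exists_norm_sub_le_of_isCover [NormedSpace ℝ F] {s : Set F}
    (hs : IsCover 1 (closedBall (0 : F) 2) s) (y : F) :
    ∃ c ∈ s, ‖(2 / ‖y‖) • y - c‖ ≤ 1 := by
  have hy : (2 / ‖y‖) • y ∈ closedBall (0 : F) 2 := by
    rw [mem_closedBall_zero_iff, norm_smul, Real.norm_of_nonneg (by positivity)]
    rw [div_mul_eq_mul_div, mul_div_assoc]
    exact mul_le_of_le_one_right zero_le_two (div_self_le_one _)
  simpa only [Set.mem_iUnion₂, mem_closedBall, dist_eq_norm, NNReal.coe_one, exists_prop] using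
    isCover_iff_subset_iUnion_closedBall.1 hs hy

theorem norm_le_of_forall_inner_le [InnerProductSpace ℝ F] {s : Set F}
    (hs : IsCover 1 (closedBall (0 : F) 2) s) {t : ℝ} {y : F} (h : ∀ u ∈ s, inner ℝ u y ≤ t) :
    ‖y‖ ≤ t := by
  obtain ⟨u, hu, hdist⟩ := exists_norm_sub_le_of_isCover hs y
  have hscaled : inner ℝ ((2 / ‖y‖) • y) y = 2 * ‖y‖ := by
    rw [real_inner_smul_left, real_inner_self_eq_norm_mul_norm, ← mul_assoc]
    rcases eq_or_ne ‖y‖ 0 with hy | hy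
    · simp only [hy, mul_zero]
    · rw [div_mul_cancel₀ _ hy]
  have hnear : inner ℝ ((2 / ‖y‖) • y - u) y ≤ ‖y‖ :=
    (real_inner_le_norm _ _).trans (mul_le_of_le_one_left (norm_nonneg y) hdist)
  rw [inner_sub_left, hscaled] at hnear
  linarith [h u hu]

theorem opNorm_le_of_forall_norm_le [NormedSpace ℝ F] {F' : Type*} [SeminormedAddCommGroup F']
    [NormedSpace ℝ F'] {s : Set F} (hs : IsCover 1 (closedBall (0 : F) 2) s) {t : ℝ}
    {T : F →L[ℝ] F'} (h : ∀ v ∈ s, ‖T v‖ ≤ t) : ‖T‖ ≤ t := by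
  have ht : 0 ≤ t := by
    obtain ⟨v, hv⟩ := hs.nonempty (nonempty_closedBall.2 zero_le_two)
    exact (norm_nonneg _).trans (h v hv)
  suffices hhalf : ‖T‖ ≤ (t + ‖T‖) / 2 by linarith
  refine T.opNorm_le_bound (by positivity) fun x => ?_
  rcases (norm_nonneg x).eq_or_lt with hx | hx
  · rw [norm_eq_zero.1 hx.symm]
    simp
  obtain ⟨v, hv, hdist⟩ := exists_norm_sub_le_of_isCover hs x
  have hscaled : ‖T ((2 / ‖x‖) • x)‖ ≤ t + ‖T‖ :=
    calc ‖T ((2 / ‖x‖) • x)‖ = ‖T v + T ((2 / ‖x‖) • x - v)‖ := by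
          rw [← map_add, add_sub_cancel]
      _ ≤ t + ‖T‖ := (norm_add_le _ _).trans
          (add_le_add (h v hv) (T.le_of_opNorm_le_of_le le_rfl hdist |>.trans_eq (mul_one _)))
  rw [map_smul, norm_smul, Real.norm_of_nonneg (by positivity), div_mul_eq_mul_div,
    div_le_iff₀ hx] at hscaled
  linarith

theorem sigmaMax_le_of_forall_inner_le {p q : ℕ} {s : Set (EuclideanSpace ℝ (Fin q))}
    {s' : Set (EuclideanSpace ℝ (Fin p))} (hs : IsCover 1 (closedBall 0 2) s)
    (hs' : IsCover 1 (closedBall 0 2) s') {A : Matrix (Fin p) (Fin q) ℝ} {t : ℝ}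
    (h : ∀ v ∈ s, ∀ u ∈ s', inner ℝ u (A.toEuclideanLin v) ≤ t) : sigmaMax A ≤ t := by
  set T := A.toEuclideanLin.toContinuousLinearMap
  have hT : ‖T‖ ≤ t := opNorm_le_of_forall_norm_le hs fun v hv =>
    norm_le_of_forall_inner_le hs' (h v hv)
  exact sigmaMax_le_of_forall_norm_le ((norm_nonneg T).trans hT) fun x =>
    T.le_of_opNorm_le hT x

end Nets

section SubgaussianMatrix

open Matrix Metric

variable {m n : ℕ} {Ω : Type*} [MeasurableSpace Ω] {μ : Measure Ω}
  {E : Ω → Matrix (Fin m) (Fin n) ℝ} {c : ℝ≥0}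

theorem hasSubgaussianMGF_of_hasLaw_gaussianReal {Z : Ω → ℝ} (h : HasLaw Z (gaussianReal 0 c) μ) :
    HasSubgaussianMGF Z c μ := by
  rw [← HasSubgaussianMGF.id_map_iff h.aemeasurable, h.map_eq]
  exact ⟨integrable_exp_mul_gaussianReal, fun t => by simp [mgf_id_gaussianReal]⟩

/- The Chernoff bound `HasSubgaussianMGF.measure_ge_le` has the junk exponent `-t² / (2 * 0) = 0`
when `a = 0`; the strict inequality makes the estimate true in that case as well. -/
theorem measureReal_mul_lt_le_exp [IsFiniteMeasure μ] {Z : Ω → ℝ} {a : ℝ≥0}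
    (h : HasSubgaussianMGF Z (a ^ 2) μ) {s : ℝ} (hs : 0 ≤ s) :
    μ.real {ω | a * s < Z ω} ≤ Real.exp (-s ^ 2 / 2) := by
  rcases eq_or_ne a 0 with rfl | ha
  · have hzero : Z =ᵐ[μ] 0 :=
      HasSubgaussianMGF.ae_eq_zero_of_hasSubgaussianMGF_zero (by simpa using h)
    have hae : ∀ᵐ ω ∂μ, ω ∉ {ω | ((0 : ℝ≥0) : ℝ) * s < Z ω} := by
      filter_upwards [hzero] with ω hω
      simp [hω]
    rw [measureReal_def, measure_eq_zero_iff_ae_notMem.2 hae, ENNReal.toReal_zero]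
    positivity
  · have ha' : (a : ℝ) ≠ 0 := mod_cast ha
    calc μ.real {ω | a * s < Z ω} ≤ μ.real {ω | a * s ≤ Z ω} :=
          measureReal_mono (Set.ofPred_subset_ofPred.2 fun _ => le_of_lt)
      _ ≤ Real.exp (-(a * s) ^ 2 / (2 * (a ^ 2 : ℝ≥0))) := h.measure_ge_le (by positivity)
      _ = Real.exp (-s ^ 2 / 2) := by
          push_cast
          congr 1
          field_simp

theorem hasSubgaussianMGF_inner_toEuclideanLin
    (hsub : ∀ i j, HasSubgaussianMGF (fun ω => E ω i j) c μ)
    (hind : iIndepFun (fun (p : Fin m × Fin n) ω => E ω p.1 p.2) μ)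
    (u : EuclideanSpace ℝ (Fin m)) (v : EuclideanSpace ℝ (Fin n)) :
    HasSubgaussianMGF (fun ω => inner ℝ u ((E ω).toEuclideanLin v))
      (‖u‖₊ ^ 2 * ‖v‖₊ ^ 2 * c) μ := by
  have hexpand (ω : Ω) : inner ℝ u ((E ω).toEuclideanLin v) =
      ∑ p : Fin m × Fin n, u p.1 * v p.2 * E ω p.1 p.2 := by
    rw [EuclideanSpace.inner_eq_star_dotProduct, Fintype.sum_prod_type]
    simp only [toLpLin_apply, dotProduct, mulVec, Finset.sum_mul, Pi.star_apply, star_trivial]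
    exact Finset.sum_congr rfl fun i _ => Finset.sum_congr rfl fun j _ => by ring
  have hparam : ‖u‖₊ ^ 2 * ‖v‖₊ ^ 2 * c =
      ∑ p : Fin m × Fin n, NNReal.mk ((u p.1 * v p.2) ^ 2) (sq_nonneg _) * c := by
    rw [← Finset.sum_mul]
    congr 1
    refine NNReal.eq ?_
    push_cast
    rw [EuclideanSpace.real_norm_sq_eq, EuclideanSpace.real_norm_sq_eq, Finset.sum_mul_sum,
      Fintype.sum_prod_type]
    simp only [mul_pow]
  rw [hparam]
  simp only [hexpand]
  exact HasSubgaussianMGF.sum_of_iIndepFun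
    (hind.comp (fun p x => u p.1 * v p.2 * x) fun _ => measurable_const_mul _)
    fun p _ => (hsub p.1 p.2).const_mul _

theorem measureReal_lt_sigmaMax_le [IsProbabilityMeasure μ] {ε : ℝ≥0}
    (hsub : ∀ i j, HasSubgaussianMGF (fun ω => E ω i j) (ε ^ 2) μ)
    (hind : iIndepFun (fun (p : Fin m × Fin n) ω => E ω p.1 p.2) μ) {s : ℝ} (hs : 0 ≤ s) :
    μ.real {ω | 4 * ε * s < sigmaMax (E ω)} ≤ 5 ^ (m + n) * Real.exp (-s ^ 2 / 2) := by
  obtain ⟨N, hNcard, hNnorm, hN⟩ := exists_finset_isCover_closedBall_two (EuclideanSpace ℝ (Fin n))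
  obtain ⟨M, hMcard, hMnorm, hM⟩ := exists_finset_isCover_closedBall_two (EuclideanSpace ℝ (Fin m))
  rw [finrank_euclideanSpace_fin] at hNcard hMcard
  have htail (p) (hp : p ∈ M ×ˢ N) :
      μ.real {ω | 4 * ε * s < inner ℝ p.1 ((E ω).toEuclideanLin p.2)} ≤
        Real.exp (-s ^ 2 / 2) := by
    obtain ⟨hu, hv⟩ := Finset.mem_product.1 hp
    have hZ := hasSubgaussianMGF_inner_toEuclideanLin hsub hind p.1 p.2
    rw [← mul_pow, ← mul_pow] at hZ
    refine le_trans (measureReal_mono (Set.ofPred_subset_ofPred.2 fun ω hω => ?_))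
      (measureReal_mul_lt_le_exp hZ hs)
    refine lt_of_le_of_lt ?_ hω
    push_cast
    gcongr
    calc ‖p.1‖ * ‖p.2‖ ≤ 2 * 2 := by gcongr; exacts [hMnorm _ hu, hNnorm _ hv]
      _ = 4 := by norm_num
  have hsubset : {ω | 4 * ε * s < sigmaMax (E ω)} ⊆
      ⋃ p ∈ M ×ˢ N, {ω | 4 * ε * s < inner ℝ p.1 ((E ω).toEuclideanLin p.2)} := by
    intro ω hω
    by_contra hnot
    simp only [Set.mem_iUnion₂, Set.mem_ofPred_eq, not_exists, not_lt, Finset.mem_product] at hnot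
    exact (sigmaMax_le_of_forall_inner_le hN hM fun v hv u hu => hnot (u, v) ⟨hu, hv⟩).not_gt hω
  calc μ.real {ω | 4 * ε * s < sigmaMax (E ω)}
      ≤ ∑ p ∈ M ×ˢ N, μ.real {ω | 4 * ε * s < inner ℝ p.1 ((E ω).toEuclideanLin p.2)} :=
        (measureReal_mono hsubset (measure_ne_top _ _)).trans
          (measureReal_biUnion_finset_le _ _)
    _ ≤ (M.card * N.card : ℕ) * Real.exp (-s ^ 2 / 2) := by
        grw [Finset.sum_le_sum htail, Finset.sum_const, nsmul_eq_mul, Finset.card_product]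
    _ ≤ 5 ^ (m + n) * Real.exp (-s ^ 2 / 2) := by
        grw [hMcard, hNcard, ← pow_add]
        push_cast
        rfl

theorem measureReal_lt_sigmaMax_le_exp [IsProbabilityMeasure μ] {ε : ℝ≥0}
    (hsub : ∀ i j, HasSubgaussianMGF (fun ω => E ω i j) (ε ^ 2) μ)
    (hind : iIndepFun (fun (p : Fin m × Fin n) ω => E ω p.1 p.2) μ) {L : ℝ} (hL : 0 ≤ L) :
    μ.real {ω | 4 * ε * √(2 * (L + 2 * (m + n))) < sigmaMax (E ω)} ≤ Real.exp (-L) := by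
  have hfive : (5 : ℝ) ≤ Real.exp 2 := by
    have := Real.quadratic_le_exp_of_nonneg zero_le_two
    linarith
  calc μ.real {ω | 4 * ε * √(2 * (L + 2 * (m + n))) < sigmaMax (E ω)}
      ≤ 5 ^ (m + n) * Real.exp (-√(2 * (L + 2 * (m + n))) ^ 2 / 2) :=
        measureReal_lt_sigmaMax_le hsub hind (Real.sqrt_nonneg _)
    _ ≤ Real.exp 2 ^ (m + n) * Real.exp (-√(2 * (L + 2 * (m + n))) ^ 2 / 2) := by gcongr
    _ = Real.exp (-L) := by
        rw [Real.sq_sqrt (by positivity), ← Real.exp_nat_mul, ← Real.exp_add]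
        push_cast
        congr 1
        ring

theorem sqrt_two_mul_add_le {L₀ L N k : ℝ} (hL₀ : 0 < L₀) (hL : L₀ ≤ L) (hN : 1 ≤ N)
    (hk : k ≤ 2 * N) : √(2 * (L + 2 * k)) ≤ √(2 + 8 / L₀) * √(N * L) := by
  have hratio : 1 ≤ L / L₀ := (one_le_div hL₀).2 hL
  have hLN : L ≤ N * L := le_mul_of_one_le_left (hL₀.le.trans hL) hN
  have hNL : N ≤ N * (L / L₀) := le_mul_of_one_le_right (by linarith) hratio
  rw [← Real.sqrt_mul (by positivity)]
  refine Real.sqrt_le_sqrt ?_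
  calc 2 * (L + 2 * k) ≤ 2 * (N * L) + 8 * (N * (L / L₀)) := by linarith
    _ = (2 + 8 / L₀) * (N * L) := by ring

end SubgaussianMatrix

section HighProbability

variable {m n : ℕ} {Ω : Type*} [MeasurableSpace Ω] {μ : Measure Ω} [IsProbabilityMeasure μ]
  {E : Ω → Matrix (Fin m) (Fin n) ℝ} {ε : ℝ≥0}

theorem exists_measurableSet_sigmaMax_le
    (hsub : ∀ i j, HasSubgaussianMGF (fun ω => E ω i j) (ε ^ 2) μ)
    (hind : iIndepFun (fun (p : Fin m × Fin n) ω => E ω p.1 p.2) μ)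
    (hmn : 1 ≤ max m n) {L₀ L : ℝ} (hL₀ : 0 < L₀) (hL : L₀ ≤ L) :
    ∃ G : Set Ω, MeasurableSet G ∧ 1 - Real.exp (-L) ≤ μ.real G ∧
      ∀ ω ∈ G, sigmaMax (E ω) ≤ 4 * √(2 + 8 / L₀) * (ε * √((max m n : ℕ) * L)) := by
  set B := {ω | 4 * ε * √(2 * (L + 2 * (m + n))) < sigmaMax (E ω)}
  have hB : μ.real B ≤ Real.exp (-L) :=
    measureReal_lt_sigmaMax_le_exp hsub hind (hL₀.le.trans hL)
  have hdim : (m + n : ℝ) ≤ 2 * (max m n : ℕ) := by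
    norm_cast
    lia
  refine ⟨(toMeasurable μ B)ᶜ, (measurableSet_toMeasurable μ B).compl, ?_, fun ω hω => ?_⟩
  · rw [probReal_compl_eq_one_sub (measurableSet_toMeasurable μ B), measureReal_def,
      measure_toMeasurable, ← measureReal_def]
    exact sub_le_sub_left hB 1
  · have hωB : ω ∉ B := fun h => hω (subset_toMeasurable μ B h)
    calc sigmaMax (E ω) ≤ 4 * ε * √(2 * (L + 2 * (m + n))) := not_lt.1 hωB
      _ ≤ 4 * ε * (√(2 + 8 / L₀) * √((max m n : ℕ) * L)) := by
          grw [sqrt_two_mul_add_le hL₀ hL (mod_cast hmn) hdim]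
      _ = 4 * √(2 + 8 / L₀) * (ε * √((max m n : ℕ) * L)) := by ring

end HighProbability

end SeqLowRank

theorem theorem3_general (γ₀ : ℝ) (hγ₀ : γ₀ < 1) :
    ∃ C : ℝ, 0 < C ∧
      ∀ (m d n r : ℕ) (X : Matrix (Fin d) (Fin n) ℝ) (Wstar : Matrix (Fin m) (Fin d) ℝ)
        (ε : ℝ≥0) (γ : ℝ),
        0 < SeqLowRank.sigmaMin X → 0 < γ → γ ≤ γ₀ →
      ∀ (Ω : Type*) [MeasurableSpace Ω] (μ : Measure Ω) [IsProbabilityMeasure μ]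
        (E : Ω → Matrix (Fin m) (Fin n) ℝ),
        (∀ i j, HasSubgaussianMGF (fun ω => E ω i j) (ε ^ 2) μ) →
        iIndepFun (fun (p : Fin m × Fin n) (ω : Ω) => E ω p.1 p.2) μ →
      ∃ G : Set Ω, MeasurableSet G ∧ 1 - γ ≤ μ.real G ∧
        ∀ ω ∈ G, ∀ Y : Matrix (Fin m) (Fin n) ℝ, Y = Wstar * X + E ω →
          ∀ (rank1 : ℕ → SeqLowRank.Rank1Routine m d n) (t : ℕ)
            (exact : ℕ → (Fin d → ℝ) × (Fin m → ℝ)),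
            (∀ k < r, SeqLowRank.IsExactRank1 X (SeqLowRank.deflated rank1 X t Y k) (exact k)) →
            ‖Wstar - ∑ k ∈ Finset.range r, SeqLowRank.outer (SeqLowRank.output rank1 X t Y k)‖ ≤
              SeqLowRank.cond X *
                (∑ k ∈ Finset.Ico r Wstar.rank, SeqLowRank.sv Wstar k +
                  SeqLowRank.linearError
                    (fun k => ‖SeqLowRank.outer (SeqLowRank.output rank1 X t Y k) -
                      SeqLowRank.outer (exact k)‖) r) +
              C * ((ε : ℝ) * √((max m n : ℕ) * Real.log (1 / γ)) / SeqLowRank.sigmaMin X * r) := by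
  set γ₁ := max γ₀ (1 / 2)
  have hγ₁ : 0 < γ₁ := lt_max_of_lt_right one_half_pos
  have hL₀ : 0 < Real.log (1 / γ₁) :=
    Real.log_pos ((one_lt_div hγ₁).2 (max_lt hγ₀ one_half_lt_one))
  refine ⟨6 * (4 * √(2 + 8 / Real.log (1 / γ₁))), by positivity, ?_⟩
  intro m d n r X Wstar ε γ hX hγ hγγ₀ Ω _ μ _ E hsub hind
  have hL : Real.log (1 / γ₁) ≤ Real.log (1 / γ) :=
    Real.log_le_log (by positivity) (one_div_le_one_div_of_le hγ (le_max_of_le_left hγγ₀))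
  obtain ⟨G, hG, hprob, hnoise⟩ := SeqLowRank.exists_measurableSet_sigmaMax_le hsub hind
    (le_max_of_le_right (SeqLowRank.width_pos_of_sigmaMin_pos hX)) hL₀ hL
  refine ⟨G, hG, ?_, fun ω hω Y hY rank1 t exact hexact => ?_⟩
  · rwa [one_div, Real.log_inv, neg_neg, Real.exp_log hγ] at hprob
  · refine (SeqLowRank.norm_sub_sum_outer_le hX hY hexact).trans (add_le_add le_rfl ?_)
    grw [hnoise ω hω]
    exact le_of_eq (by ring)

theorem theorem3 :
    ∃ c : ℝ, 0 < c ∧ ∀ γ₀ : ℝ, γ₀ < 1 → ∃ C : ℝ, 0 < C ∧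
      ∀ (m d n r : ℕ) (X : Matrix (Fin d) (Fin n) ℝ) (Wstar : Matrix (Fin m) (Fin d) ℝ)
        (ε : ℝ≥0) (γ : ℝ),
        m ≤ n → 1 ≤ r → 0 < SeqLowRank.sigmaMin X → 0 < γ → γ ≤ γ₀ →
      ∀ (Ω : Type*) [MeasurableSpace Ω] (μ : Measure Ω) [IsProbabilityMeasure μ]
        (E : Ω → Matrix (Fin m) (Fin n) ℝ),
        (∀ i j, HasLaw (fun ω => E ω i j) (gaussianReal 0 (ε ^ 2)) μ) →
        iIndepFun (fun (p : Fin m × Fin n) (ω : Ω) => E ω p.1 p.2) μ →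
      ∃ G : Set Ω, MeasurableSet G ∧ 1 - γ ≤ μ.real G ∧
        ∀ ω ∈ G, ∀ Y : Matrix (Fin m) (Fin n) ℝ, Y = Wstar * X + E ω →
          0 < SeqLowRank.gapMin Y r →
          (ε : ℝ) ≤ c * (SeqLowRank.gapMin Y r / (√(n : ℝ) + √(Real.log (1 / γ)))) →
          ∀ (rank1 : ℕ → SeqLowRank.Rank1Routine m d n) (t : ℕ)
            (exact : ℕ → (Fin d → ℝ) × (Fin m → ℝ)),
            (∀ k < r, SeqLowRank.IsExactRank1 X (SeqLowRank.deflated rank1 X t Y k) (exact k)) →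
            ‖Wstar - ∑ k ∈ Finset.range r, SeqLowRank.outer (SeqLowRank.output rank1 X t Y k)‖ ≤
              SeqLowRank.cond X *
                (∑ k ∈ Finset.Ico r Wstar.rank, SeqLowRank.sv Wstar k +
                  SeqLowRank.accumulatedError Y
                    (fun k => ‖SeqLowRank.outer (SeqLowRank.output rank1 X t Y k) -
                      SeqLowRank.outer (exact k)‖) r) +
              C * ((ε : ℝ) * √((n : ℝ) * Real.log (1 / γ)) / SeqLowRank.sigmaMin X *
                ((r : ℝ) + √(((min Wstar.rank r : ℕ) : ℝ) / SeqLowRank.gapMin Y r))) := by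
  refine ⟨1, one_pos, fun γ₀ hγ₀ => ?_⟩
  obtain ⟨C, hC, hgeneral⟩ := theorem3_general γ₀ hγ₀
  refine ⟨C, hC, fun m d n r X Wstar ε γ hmn _ hX hγ hγγ₀ Ω _ μ _ E hlaw hind => ?_⟩
  obtain ⟨G, hG, hprob, hbound⟩ := hgeneral m d n r X Wstar ε γ hX hγ hγγ₀ Ω μ E
    (fun i j => SeqLowRank.hasSubgaussianMGF_of_hasLaw_gaussianReal (hlaw i j)) hind
  refine ⟨G, hG, hprob, fun ω hω Y hY hgap _ rank1 t exact hexact => ?_⟩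
  have hcond : 0 ≤ SeqLowRank.cond X := div_nonneg (SeqLowRank.sigmaMax_nonneg X) hX.le
  rw [max_eq_right hmn] at hbound
  grw [hbound ω hω Y hY rank1 t exact hexact,
    SeqLowRank.linearError_le_accumulatedError hgap fun _ => norm_nonneg _]
  gcongr
  exact le_add_of_nonneg_right (Real.sqrt_nonneg _)
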